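/- Consider the class of generalized Burgers equations with linear damping $$u_t+u^nu_x+hu=g(t)u_{xx},\qquad u>0,$$ whose arbitrary elements are a constant $n\ne0$, a constant $h$ and a smooth nowhere vanishing function $g=g(t)$ on an open interval. A (local) generalized equivalence transformation of this class is a smooth map $(t,x,u,n,h,g)\mapsto(\tilde t,\tilde x,\tilde u,\tilde n,\tilde h,\tilde g)$ with nonvanishing Jacobian and $\tilde u>0$, defined on an open subset $\Omega$ of $\{u>0,\ n\ne0,\ g\ne0\}$ whose slices at fixed $(n,h)$ are connected or empty, such that for every tuple $(n,h,g(\cdot))$ of arbitrary elements, $(\tilde n,\tilde h,\tilde g)$ is, along $g=g(t)$, again a tuple of arbitrary elements of the class (constants $\tilde n\neq0$, $\tilde h$ and a smooth nowhere vanishing function $\tilde g=\tilde g(\tilde t)$ on an open interval), and the point transformation $(t,x,u)\mapsto(\tilde t,\tilde x,\tilde u)$ obtained by substituting these arbitrary elements maps the equation with arbitrary elements $(n,h,g)$ to the equation $\tilde u_{\tilde t}+\tilde u^{\tilde n}\tilde u_{\tilde x}+\tilde h\tilde u=\tilde g(\tilde t)\tilde u_{\tilde x\tilde x}$ (as manifolds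 in the second-order jet space). These transformations form the generalized equivalence group $\hat G^\sim_{h=\mathrm{const}}$ of the class. **Corollary.** The generalized equivalence group $\hat G^\sim_{h=\mathrm{const}}$ consists exactly of the transformations $$\tilde t=T(t),\quad \tilde x=\delta_1x+\delta_0,\quad \tilde u=\Big(\frac{\delta_1}{\alpha}\Big)^{\frac1n}e^{ht-\tilde hT}u,\quad \tilde g=\frac{\delta_1^2}{\alpha}e^{nht-n\tilde hT}g,\quad \tilde n=n,$$ where the function $T=T(t)$ depends on $h$ and $\tilde h$ and is defined by $$\begin{array}{ll} h\tilde h\ne0:\ \ \dfrac{e^{-n\tilde hT}-1}{-n\tilde h}=\alpha\dfrac{e^{-nht}-1}{-nh}+\beta, & h\ne0,\ \tilde h=0:\ \ T=\alpha\dfrac{e^{-nht}-1}{-nh}+\beta,\\[3mm] h=0,\ \tilde h\ne0:\ \ \dfrac{e^{-n\tilde hT}-1}{-n\tilde h}=\alpha t+\beta, & h=\tilde h=0:\ \ T=\alpha t+\beta. \end{array}$$ Here $\alpha,\beta,\delta_0,\delta_1$ are arbitrary constants with $\alpha\delta_1>0$ and $\tilde h$ is a constant; that is, these five quantities do not depend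 on $(t,x,u,g)$, but may be arbitrary smooth functions of the constant arbitrary elements $(n,h)$ (on the set of values of $(n,h)$ occurring in $\Omega$), subject only to $\alpha\delta_1>0$ and $\partial\tilde h/\partial h\ne0$. -/

import Mathlib

open scoped ContDiff Topology

namespace GenBurgers

/-- The function `v = v(t, x)` satisfies the generalized Burgers equation
`u_t + u ^ n u_x + h u = g(t) u_xx`, with constant damping coefficient `h`, at the point `(t, x)`. -/
def SatisfiesAt (n h : ℝ) (g : ℝ → ℝ) (v : ℝ → ℝ → ℝ) (t x : ℝ) : Prop :=
  deriv (fun s => v s x) t + v t x ^ n * deriv (fun y => v t y) x + h * v t x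
    = g t * iteratedDeriv 2 (fun y => v t y) x

/-- The tuple `(n, h, g)` of arbitrary elements, with `h` and `n` constant and `g` a function on
the open interval `I`, belongs to the class: `n ≠ 0`, and `g` is smooth and nowhere zero. -/
structure InClass (n h : ℝ) (g : ℝ → ℝ) (I : Set ℝ) : Prop where
  isOpen : IsOpen I
  ordConnected : I.OrdConnected
  exponent_ne_zero : n ≠ 0
  smooth : ContDiffOn ℝ ∞ g I
  ne_zero : ∀ t ∈ I, g t ≠ 0

/-- The space with the coordinates `![t, x, u, n, h, g]`: the independent variables, the dependent
variable and the arbitrary elements of the class. -/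
abbrev JointSpace : Type := Fin 6 → ℝ

/-- Domains of local transformations of the joint space: open sets in the region
`u > 0`, `n ≠ 0`, `g ≠ 0` whose slices, for fixed constants `n` and `h`, are connected
(or empty). -/
structure IsTransformationDomain (Ω : Set JointSpace) : Prop where
  isOpen : IsOpen Ω
  u_pos : ∀ z ∈ Ω, 0 < z 2
  n_ne_zero : ∀ z ∈ Ω, z 3 ≠ 0
  g_ne_zero : ∀ z ∈ Ω, z 5 ≠ 0
  slice : ∀ n h : ℝ, IsPreconnected {z ∈ Ω | z 3 = n ∧ z 4 = h}

/-- The set of values of `(n, h)` that occur in `Ω`. -/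
def constants (Ω : Set JointSpace) : Set (ℝ × ℝ) := (fun z => (z 3, z 4)) '' Ω

/-- The point transformation `t̃ = T(t, x, u)`, `x̃ = X(t, x, u)`, `ũ = U(t, x, u)` with domain `D`
maps the equation with the arbitrary elements `(n, h, g)` to the equation with the arbitrary
elements `(N, H, G)`, as submanifolds of the second-order jet space:
whenever it maps the graph of `v` near `(t, x)` into the graph of `w`, the function `v` satisfies
the first equation at `(t, x)` if and only if `w` satisfies the second one at the image point. -/
def MapsEquation (D : Set (ℝ × ℝ × ℝ)) (T X U : ℝ → ℝ → ℝ → ℝ)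
    (n h : ℝ) (g : ℝ → ℝ) (N H : ℝ) (G : ℝ → ℝ) : Prop :=
  ∀ (v w : ℝ → ℝ → ℝ) (t x : ℝ), (t, x, v t x) ∈ D →
    ContDiffAt ℝ ∞ (Function.uncurry v) (t, x) →
    ContDiffAt ℝ ∞ (Function.uncurry w) (T t x (v t x), X t x (v t x)) →
    (∀ᶠ p : ℝ × ℝ in 𝓝 (t, x),
      w (T p.1 p.2 (v p.1 p.2)) (X p.1 p.2 (v p.1 p.2)) = U p.1 p.2 (v p.1 p.2)) →
    (SatisfiesAt n h g v t x ↔ SatisfiesAt N H G w (T t x (v t x)) (X t x (v t x)))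

/-- `Φ`, with domain `Ω`, belongs to the generalized equivalence (pseudo)group of the class of
equations `u_t + u ^ n u_x + h u = g(t) u_xx` with constant `h`: it is a nondegenerate smooth
transformation of the joint space of the variables and the arbitrary elements, and for every tuple
of arbitrary elements of the class, its components for `n`, `h` and `g` give a tuple of arbitrary
elements of the class such that its components for `t`, `x` and `u`, evaluated at the given
arbitrary elements, map the initial equation to the equation with the new arbitrary elements. -/
structure IsGenEquivTransformation (Ω : Set JointSpace) (Φ : JointSpace → JointSpace) :
    Prop where
  smooth : ContDiffOn ℝ ∞ Φ Ω
  nondegenerate : ∀ z ∈ Ω, (fderiv ℝ Φ z).det ≠ 0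
  u_pos : ∀ z ∈ Ω, 0 < Φ z 2
  maps_class : ∀ (n h : ℝ) (g : ℝ → ℝ) (I : Set ℝ), InClass n h g I →
    ∃ (N H : ℝ) (G : ℝ → ℝ) (J : Set ℝ), InClass N H G J ∧
      (∀ t x u : ℝ, t ∈ I → ![t, x, u, n, h, g t] ∈ Ω →
        Φ ![t, x, u, n, h, g t] 3 = N ∧
        Φ ![t, x, u, n, h, g t] 4 = H ∧
        Φ ![t, x, u, n, h, g t] 0 ∈ J ∧
        Φ ![t, x, u, n, h, g t] 5 = G (Φ ![t, x, u, n, h, g t] 0)) ∧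
      MapsEquation {p | p.1 ∈ I ∧ ![p.1, p.2.1, p.2.2, n, h, g p.1] ∈ Ω}
        (fun t x u => Φ ![t, x, u, n, h, g t] 0)
        (fun t x u => Φ ![t, x, u, n, h, g t] 1)
        (fun t x u => Φ ![t, x, u, n, h, g t] 2)
        n h g N H G

/-- The relation that defines the value `T` of the new time at the time `t`, in the four cases of
zero or nonzero initial and new damping coefficients `h` and `H`. -/
def TimeRelation (n h H α β t T : ℝ) : Prop :=
  (h ≠ 0 → H ≠ 0 →
    (Real.exp (-n * H * T) - 1) / (-n * H) = α * ((Real.exp (-n * h * t) - 1) / (-n * h)) + β) ∧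
  (h ≠ 0 → H = 0 → T = α * ((Real.exp (-n * h * t) - 1) / (-n * h)) + β) ∧
  (h = 0 → H ≠ 0 → (Real.exp (-n * H * T) - 1) / (-n * H) = α * t + β) ∧
  (h = 0 → H = 0 → T = α * t + β)

end GenBurgers

/-! Write `T`, `X`, `U`, `N`, `H`, `G` for the six components of `Φ`, with subscripts for partial
derivatives.

Necessity. The hypothesis quantifies over all functions, but everything is extracted at one point at
a time. Testing on a quadratic polynomial for `u` and an exponential for `g` realizes arbitrary
values of `u_t`, `u_x`, `u_xx`, `u_tt` and `g_t` at the point. The inverse function theorem makes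
the image of the graph again a graph, so the condition becomes an equivalence between two algebraic
relations on jets (`exists_transformed_graph`, `jet_condition`). Splitting this relation gives
everything. The source equation does not contain `u_tt`, which forces `T_x = T_u = 0`; nondegeneracy
for every value of `g_t` forces `T_g = 0`. The coefficient of `u_xx` gives `X_u = 0` and `g X_x² = G
T_t`; those of powers of `u_x` and of `g_t` give `U_uu = U_g = X_g = 0` and two further equations
(`determining_equations`). Since `g` is itself a coordinate, one of these splits once more, giving
`U_xu = 0` and `U^N T_t = u^n X_x + X_t`. As `U` is affine in `u`, comparing powers gives `N = n`,
and for `n ≠ 1` that `U` is proportional to `u`. The exceptional value `n = 1` is removed by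
continuity in `n` (`dependent_eq`); this is where varying the constants matters. What remains is
`X_t = 0`, `U_x = 0`, `U_u^n T_t = X_x`, `U_t = (h - H T_t) U`. These equations integrate to
quantities with no derivative in `t`, `x`, `u`, `g`. Connectedness of the slices makes them
functions of `(n, h)`, namely the parameters (`exists_parameters`).

Sufficiency. The four cases of the time relation are one equation between values of the
antiderivative `expInt` of an exponential, jointly smooth and strictly increasing in time. Hence the
new time is a smooth function of `(t, n, h)`, the Jacobian is triangular, and substitution
multiplies the residual of the equation by a nonzero factor (`satisfiesAt_iff_of_standard`). -/

namespace GenBurgers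

/-! ### Calculus in coordinates on the joint space -/

section Calculus

/-- Second derivative of a function along a curve. -/
theorem iteratedDeriv_two_comp {E : Type*} [NormedAddCommGroup E] [NormedSpace ℝ E]
    {F : E → ℝ} {γ : ℝ → E} {s₀ : ℝ} (hF : ContDiffAt ℝ ∞ F (γ s₀)) (hγ : ContDiffAt ℝ ∞ γ s₀) :
    iteratedDeriv 2 (fun s => F (γ s)) s₀ =
      fderiv ℝ (fderiv ℝ F) (γ s₀) (deriv γ s₀) (deriv γ s₀) +
        fderiv ℝ F (γ s₀) (deriv (deriv γ) s₀) := by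
  have hF1 : ∀ᶠ z in 𝓝 (γ s₀), DifferentiableAt ℝ F z := by
    filter_upwards [(hF.of_le (m := 1) (by norm_cast)).eventually (by simp)] with z hz
    exact hz.differentiableAt (by simp)
  have hγ1 : ∀ᶠ s in 𝓝 s₀, DifferentiableAt ℝ γ s := by
    filter_upwards [(hγ.of_le (m := 1) (by norm_cast)).eventually (by simp)] with z hz
    exact hz.differentiableAt (by simp)
  have hd : deriv (fun s => F (γ s)) =ᶠ[𝓝 s₀] fun s => fderiv ℝ F (γ s) (deriv γ s) := by
    filter_upwards [hγ.continuousAt.eventually hF1, hγ1] with s h1 h2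
    exact (h1.hasFDerivAt.comp_hasDerivAt s h2.hasDerivAt).deriv
  rw [iteratedDeriv_succ, iteratedDeriv_one, hd.deriv_eq]
  have hF2 : DifferentiableAt ℝ (fderiv ℝ F) (γ s₀) :=
    (hF.fderiv_right (m := 1) (by norm_cast)).differentiableAt (by simp)
  have hγ2 : DifferentiableAt ℝ (deriv γ) s₀ := by
    have : ContDiffAt ℝ 1 (fderiv ℝ γ) s₀ := hγ.fderiv_right (m := 1) (by norm_cast)
    exact (this.differentiableAt (by simp)).clm_apply (differentiableAt_const _)
  have h1 := hF2.hasFDerivAt.comp_hasDerivAt s₀ (hγ.differentiableAt (by simp)).hasDerivAt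
  exact (h1.clm_apply hγ2.hasDerivAt).deriv

end Calculus

/-- Partial derivative on the joint space. -/
noncomputable def pd (i : Fin 6) (F : JointSpace → ℝ) (z : JointSpace) : ℝ :=
  fderiv ℝ F z (Pi.single i 1)

theorem fderiv_eq_sum_pd (F : JointSpace → ℝ) (z V : JointSpace) :
    fderiv ℝ F z V = ∑ i, V i * pd i F z := by
  conv_lhs => rw [pi_eq_sum_univ' V]
  simp only [map_sum, map_smul, smul_eq_mul, pd]

variable {Ω : Set JointSpace} {F F' : JointSpace → ℝ} {z : JointSpace}

theorem contDiffOn_pd (hΩ : IsOpen Ω) (hF : ContDiffOn ℝ ∞ F Ω) (i : Fin 6) :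
    ContDiffOn ℝ ∞ (pd i F) Ω :=
  (hF.fderiv_of_isOpen hΩ (m := ∞) (by simp)).clm_apply contDiffOn_const

theorem contDiffAt_of_mem (hΩ : IsOpen Ω) (hF : ContDiffOn ℝ ∞ F Ω) (hz : z ∈ Ω) :
    ContDiffAt ℝ ∞ F z := hF.contDiffAt (hΩ.mem_nhds hz)

theorem differentiableAt_of_mem (hΩ : IsOpen Ω) (hF : ContDiffOn ℝ ∞ F Ω) (hz : z ∈ Ω) :
    DifferentiableAt ℝ F z := (contDiffAt_of_mem hΩ hF hz).differentiableAt (by simp)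

theorem fderiv_fderiv_apply (hF : ContDiffAt ℝ ∞ F z) (V : JointSpace) (j : Fin 6) :
    fderiv ℝ (fderiv ℝ F) z V (Pi.single j 1) = fderiv ℝ (pd j F) z V := by
  have hF2 : DifferentiableAt ℝ (fderiv ℝ F) z :=
    (hF.fderiv_right (m := 1) (by norm_cast)).differentiableAt (by simp)
  have := hF2.hasFDerivAt.clm_apply (hasFDerivAt_const (Pi.single j (1 : ℝ)) z)
  have h2 : fderiv ℝ (pd j F) z = _ := this.fderiv
  rw [h2]
  simp

theorem pd_comm (hΩ : IsOpen Ω) (hF : ContDiffOn ℝ ∞ F Ω) (hz : z ∈ Ω) (i j : Fin 6) :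
    pd i (pd j F) z = pd j (pd i F) z := by
  have h := contDiffAt_of_mem hΩ hF hz
  have hs : IsSymmSndFDerivAt ℝ F z := h.isSymmSndFDerivAt (by simp; norm_cast)
  have := hs (Pi.single i 1) (Pi.single j 1)
  rwa [fderiv_fderiv_apply h, fderiv_fderiv_apply h] at this

theorem pd_congr (hΩ : IsOpen Ω) (h : ∀ z ∈ Ω, F z = F' z) (hz : z ∈ Ω) (i : Fin 6) :
    pd i F z = pd i F' z := by
  have : F =ᶠ[𝓝 z] F' := by filter_upwards [hΩ.mem_nhds hz] with y hy using h y hy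
  rw [pd, pd, this.fderiv_eq]

theorem pd_eq_zero (hΩ : IsOpen Ω) (h : ∀ z ∈ Ω, F z = 0) (hz : z ∈ Ω) (i : Fin 6) :
    pd i F z = 0 := by
  rw [pd_congr (F' := fun _ => 0) hΩ h hz]
  simp [pd]

theorem pd_pd_eq_zero (hΩ : IsOpen Ω) (hF : ContDiffOn ℝ ∞ F Ω) {i : Fin 6}
    (h : ∀ z ∈ Ω, pd i F z = 0) (hz : z ∈ Ω) (j : Fin 6) : pd i (pd j F) z = 0 := by
  rw [pd_comm hΩ hF hz]
  exact pd_eq_zero hΩ h hz j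

theorem fderiv_fderiv_eq_sum (hF : ContDiffAt ℝ ∞ F z) (V W : JointSpace) :
    fderiv ℝ (fderiv ℝ F) z V W = ∑ j, W j * ∑ i, V i * pd i (pd j F) z := by
  conv_lhs => rw [pi_eq_sum_univ' W]
  simp only [map_sum, map_smul, smul_eq_mul]
  refine Finset.sum_congr rfl fun j _ => ?_
  rw [← fderiv_eq_sum_pd, ← fderiv_fderiv_apply hF]

/-- A function whose derivative along `z' - z` vanishes on a convex set takes equal values at `z`
and `z'`. -/
theorem eq_of_fderiv_eq_zero {s : Set JointSpace} (hs : Convex ℝ s)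
    (hF : ∀ y ∈ s, DifferentiableAt ℝ F y) {z z' : JointSpace} (hz : z ∈ s) (hz' : z' ∈ s)
    (h : ∀ y ∈ s, fderiv ℝ F y (z' - z) = 0) : F z' = F z := by
  obtain ⟨y, hy, hyz⟩ := domain_mvt (f' := fderiv ℝ F)
    (fun y hy => (hF y hy).hasFDerivAt.hasFDerivWithinAt) hs hz hz'
  rw [h y (hs.segment_subset hz hz' hy)] at hyz
  linarith

/-- A function with vanishing derivatives with respect to `t`, `x`, `u`, `g` is constant on the
slices of the domain. -/
theorem eq_of_mem_slice (hΩ : IsTransformationDomain Ω) (hF : ∀ y ∈ Ω, DifferentiableAt ℝ F y)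
    (h : ∀ y ∈ Ω, pd 0 F y = 0 ∧ pd 1 F y = 0 ∧ pd 2 F y = 0 ∧ pd 5 F y = 0)
    {z z' : JointSpace} (hz : z ∈ Ω) (hz' : z' ∈ Ω) (h3 : z 3 = z' 3) (h4 : z 4 = z' 4) :
    F z = F z' := by
  set S : Set JointSpace := {y ∈ Ω | y 3 = z 3 ∧ y 4 = z 4} with hS
  have hpre : PreconnectedSpace S := Subtype.preconnectedSpace (hΩ.slice (z 3) (z 4))
  have hloc : IsLocallyConstant (fun y : S => F y) := by
    rw [IsLocallyConstant.iff_eventually_eq]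
    rintro ⟨y, hy, hy3, hy4⟩
    obtain ⟨ε, hε, hball⟩ := Metric.isOpen_iff.1 hΩ.isOpen y hy
    have : ∀ᶠ y' : S in 𝓝 ⟨y, hy, hy3, hy4⟩, (y' : JointSpace) ∈ Metric.ball y ε :=
      continuousAt_subtype_val.eventually (Metric.ball_mem_nhds y hε)
    filter_upwards [this] with y' hy'
    refine eq_of_fderiv_eq_zero (convex_ball y ε) (fun w hw => hF w (hball hw))
      (Metric.mem_ball_self hε) hy' fun w hw => ?_
    obtain ⟨h0, h1, h2, h5⟩ := h w (hball hw)
    -- Two points of one slice differ by a vector without `n` and `h` components, so only the four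
    -- vanishing derivatives enter.
    have e3 : (y' : JointSpace) 3 = y 3 := by rw [y'.2.2.1, hy3]
    have e4 : (y' : JointSpace) 4 = y 4 := by rw [y'.2.2.2, hy4]
    rw [fderiv_eq_sum_pd, Fin.sum_univ_six]
    simp [h0, h1, h2, h5, e3, e4]
  exact hloc.apply_eq_of_preconnectedSpace ⟨z, hz, rfl, rfl⟩ ⟨z', hz', h3.symm, h4.symm⟩

theorem eventually_mem_line (hΩ : IsOpen Ω) (hz : z ∈ Ω) (V : JointSpace) :
    ∀ᶠ s : ℝ in 𝓝 0, z + s • V ∈ Ω := by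
  have : ContinuousAt (fun s : ℝ => z + s • V) 0 := by fun_prop
  exact this.eventually (by simpa using hΩ.mem_nhds hz)

theorem hasDerivAt_line (hF : DifferentiableAt ℝ F z) (V : JointSpace) {s : ℝ} {y : JointSpace}
    (hy : y + s • V = z) : HasDerivAt (fun s : ℝ => F (y + s • V)) (fderiv ℝ F z V) s := by
  subst hy
  have h1 : HasDerivAt (fun s : ℝ => y + s • V) V s := by
    simpa using ((hasDerivAt_id s).smul_const V).const_add y
  exact hF.hasFDerivAt.comp_hasDerivAt s h1

/-- A function with a vanishing partial derivative is locally constant along the corresponding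
coordinate lines. -/
theorem eventually_eq_of_pd_eq_zero (hΩ : IsOpen Ω) (hF : ContDiffOn ℝ ∞ F Ω) {i : Fin 6}
    (h : ∀ y ∈ Ω, pd i F y = 0) (hz : z ∈ Ω) :
    ∀ᶠ s : ℝ in 𝓝 0, F (z + s • Pi.single i 1) = F z := by
  obtain ⟨ε, hε, hball⟩ := Metric.isOpen_iff.1 hΩ z hz
  filter_upwards [eventually_mem_line Metric.isOpen_ball (Metric.mem_ball_self hε)
    (Pi.single i 1)] with s hs
  refine eq_of_fderiv_eq_zero (convex_ball z ε)
    (fun w hw => differentiableAt_of_mem hΩ hF (hball hw)) (Metric.mem_ball_self hε) hs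
    fun w hw => ?_
  rw [add_sub_cancel_left, map_smul]
  exact (congrArg _ (h w (hball hw))).trans (smul_zero s)

end GenBurgers

/-! ### Prolongation of a transformation to second-order jets -/

namespace GenBurgers

/-- If the differential of `(t, x) ↦ (F₀, F₁)` along the surface `ι` is invertible, then the image
of the surface under `(F₀, F₁, F₂)` is locally the graph of a function `w`, whose derivatives are
given by the usual prolongation formulas. -/
theorem exists_transformed_graph {ι : ℝ × ℝ → JointSpace} {p : ℝ × ℝ} {z τ χ : JointSpace}
    (hι : ContDiffAt ℝ ∞ ι p) (hz : ι p = z) (hτ : fderiv ℝ ι p (1, 0) = τ)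
    (hχ : fderiv ℝ ι p (0, 1) = χ) {F₀ F₁ F₂ : JointSpace → ℝ}
    (h₀ : ContDiffAt ℝ ∞ F₀ z) (h₁ : ContDiffAt ℝ ∞ F₁ z) (h₂ : ContDiffAt ℝ ∞ F₂ z)
    {P Q R S Δ et ex wT wX : ℝ} (hP : P = fderiv ℝ F₀ z τ) (hQ : Q = fderiv ℝ F₀ z χ)
    (hR : R = fderiv ℝ F₁ z τ) (hS : S = fderiv ℝ F₁ z χ) (hΔ : Δ = P * S - Q * R) (hΔ0 : Δ ≠ 0)
    (het : et = -Q / Δ) (hex : ex = P / Δ)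
    (hwT : wT = (S * fderiv ℝ F₂ z τ - R * fderiv ℝ F₂ z χ) / Δ)
    (hwX : wX = (P * fderiv ℝ F₂ z χ - Q * fderiv ℝ F₂ z τ) / Δ)
    {E W : JointSpace} (hE : E = et • τ + ex • χ)
    (hW : W = deriv (deriv fun s : ℝ => ι (p + s • (et, ex))) 0) :
    ∃ w : ℝ → ℝ → ℝ, ContDiffAt ℝ ∞ (Function.uncurry w) (F₀ z, F₁ z) ∧
      (∀ᶠ q in 𝓝 p, w (F₀ (ι q)) (F₁ (ι q)) = F₂ (ι q)) ∧
      deriv (fun s => w s (F₁ z)) (F₀ z) = wT ∧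
      deriv (fun y => w (F₀ z) y) (F₁ z) = wX ∧
      iteratedDeriv 2 (fun y => w (F₀ z) y) (F₁ z) =
        (fderiv ℝ (fderiv ℝ F₂) z E E + fderiv ℝ F₂ z W)
          - wT * (fderiv ℝ (fderiv ℝ F₀) z E E + fderiv ℝ F₀ z W)
          - wX * (fderiv ℝ (fderiv ℝ F₁) z E E + fderiv ℝ F₁ z W) := by
  subst hz
  have hcomp : ∀ {F : JointSpace → ℝ}, ContDiffAt ℝ ∞ F (ι p) →
      ContDiffAt ℝ ∞ (fun q => F (ι q)) p ∧
      ∀ a b : ℝ, fderiv ℝ (fun q => F (ι q)) p (a, b) =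
        a * fderiv ℝ F (ι p) τ + b * fderiv ℝ F (ι p) χ := by
    intro F hF
    refine ⟨hF.comp p hι, fun a b => ?_⟩
    have h := (hF.differentiableAt (by simp)).hasFDerivAt.comp p
      (hι.differentiableAt (by simp)).hasFDerivAt
    have h' : fderiv ℝ (fun q => F (ι q)) p = _ := h.fderiv
    have hab : ((a, b) : ℝ × ℝ) = a • (1, 0) + b • (0, 1) := by simp
    rw [h', ContinuousLinearMap.comp_apply, hab, map_add, map_smul, map_smul, hτ, hχ]
    simp
  obtain ⟨hs₀, hd₀⟩ := hcomp h₀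
  obtain ⟨hs₁, hd₁⟩ := hcomp h₁
  obtain ⟨hs₂, hd₂⟩ := hcomp h₂
  set m : ℝ × ℝ → ℝ × ℝ := fun q => (F₀ (ι q), F₁ (ι q)) with hm
  have hms : ContDiffAt ℝ ∞ m p := hs₀.prodMk hs₁
  have hmd : ∀ a b : ℝ, fderiv ℝ m p (a, b) = (a * P + b * Q, a * R + b * S) := by
    intro a b
    have h := ((hs₀.differentiableAt (by simp)).hasFDerivAt.prodMk
      (hs₁.differentiableAt (by simp)).hasFDerivAt).fderiv
    have h' : fderiv ℝ m p = _ := h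
    rw [h', ContinuousLinearMap.prod_apply, hd₀, hd₁, hP, hQ, hR, hS]
  have hinj : Function.Injective (fderiv ℝ m p : ℝ × ℝ →ₗ[ℝ] ℝ × ℝ) := by
    rw [← LinearMap.ker_eq_bot, LinearMap.ker_eq_bot']
    rintro ⟨a, b⟩ hab
    have hab' : fderiv ℝ m p (a, b) = 0 := hab
    rw [hmd, Prod.mk_eq_zero] at hab'
    have ha : a * Δ = 0 := by rw [hΔ]; linear_combination S * hab'.1 - Q * hab'.2
    have hb : b * Δ = 0 := by rw [hΔ]; linear_combination P * hab'.2 - R * hab'.1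
    simp only [mul_eq_zero, hΔ0, or_false] at ha hb
    simp [ha, hb]
  let e := (LinearEquiv.ofInjectiveEndo _ hinj).toContinuousLinearEquiv
  have he : HasFDerivAt m (e : ℝ × ℝ →L[ℝ] ℝ × ℝ) p := by
    have : (e : ℝ × ℝ →L[ℝ] ℝ × ℝ) = fderiv ℝ m p := by
      ext <;> rfl
    rw [this]
    exact (hms.differentiableAt (by simp)).hasFDerivAt
  set inv := hms.localInverse he (by simp) with hinv
  have hinvs : ContDiffAt ℝ ∞ inv (m p) := hms.to_localInverse he (by simp)
  have hleft : ∀ᶠ q in 𝓝 p, inv (m q) = q :=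
    (hms.hasStrictFDerivAt' he (by simp)).eventually_left_inverse
  have hinvp : inv (m p) = p := hleft.self_of_nhds
  let wf : ℝ × ℝ → ℝ := fun q => F₂ (ι (inv q))
  have hwf : ContDiffAt ℝ ∞ wf (m p) := by
    have hs₂' : ContDiffAt ℝ ∞ (fun q => F₂ (ι q)) (inv (m p)) := by rwa [hinvp]
    exact hs₂'.comp (m p) hinvs
  have hrel : (fun q => wf (m q)) =ᶠ[𝓝 p] fun q => F₂ (ι q) := by
    filter_upwards [hleft] with q hq
    simp only [wf, hq]
  have hwfd : ∀ v, fderiv ℝ wf (m p) (fderiv ℝ m p v) = fderiv ℝ (fun q => F₂ (ι q)) p v := by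
    intro v
    have h := (hwf.differentiableAt (by simp)).hasFDerivAt.comp p
      (hms.differentiableAt (by simp)).hasFDerivAt
    rw [← hrel.fderiv_eq]
    have h' : fderiv ℝ (fun q => wf (m q)) p = _ := h.fderiv
    rw [h']
    rfl
  -- Cramer's rule: `(et, ex)` is the direction that `m` carries to the new `x` direction, and `(S /
  -- Δ, -R / Δ)` the one carried to the new `t` direction.
  have hme : fderiv ℝ m p (et, ex) = (0, 1) := by
    rw [hmd, het, hex]
    ext
    · simp; field_simp; ring
    · simp; field_simp; rw [hΔ]; ring
  have hme' : fderiv ℝ m p (S / Δ, -R / Δ) = (1, 0) := by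
    rw [hmd]
    ext
    · simp; field_simp; rw [hΔ]; ring
    · simp; field_simp; ring
  have hfX : fderiv ℝ wf (m p) (0, 1) = wX := by
    rw [← hme, hwfd, hd₂, het, hex, hwX]; ring
  have hfT : fderiv ℝ wf (m p) (1, 0) = wT := by
    rw [← hme', hwfd, hd₂, hwT]; ring
  have hfab : ∀ a b : ℝ, fderiv ℝ wf (m p) (a, b) = a * wT + b * wX := by
    intro a b
    have hab : ((a, b) : ℝ × ℝ) = a • (1, 0) + b • (0, 1) := by simp
    rw [hab, map_add, map_smul, map_smul, hfX, hfT]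
    simp
  have hwfdiff := (hwf.differentiableAt (by simp)).hasFDerivAt
  refine ⟨fun s y => wf (s, y), hwf, hrel, ?_, ?_, ?_⟩
  · have h := hwfdiff.comp_hasDerivAt (F₀ (ι p))
      ((hasDerivAt_id (F₀ (ι p))).prodMk (hasDerivAt_const (F₀ (ι p)) (F₁ (ι p))))
    rw [← hfT]
    exact h.deriv
  · have h := hwfdiff.comp_hasDerivAt (F₁ (ι p))
      ((hasDerivAt_const (F₁ (ι p)) (F₀ (ι p))).prodMk (hasDerivAt_id (F₁ (ι p))))
    rw [← hfX]
    exact h.deriv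
  · have hvert : iteratedDeriv 2 (fun y => wf (F₀ (ι p), y)) (F₁ (ι p)) =
        fderiv ℝ (fderiv ℝ wf) (m p) (0, 1) (0, 1) := by
      have hcd : deriv (fun y : ℝ => (F₀ (ι p), y)) = fun _ => ((0, 1) : ℝ × ℝ) := by
        funext y
        exact ((hasDerivAt_const y (F₀ (ι p))).prodMk (hasDerivAt_id y)).deriv
      have h := iteratedDeriv_two_comp (F := wf) (γ := fun y : ℝ => (F₀ (ι p), y))
        (s₀ := F₁ (ι p)) hwf (by fun_prop)
      rw [h, hcd]
      simp [hm]
    -- The image of this line under `m` is tangent to the new `x` axis but may be curved.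
    -- Differentiating `wf ∘ m ∘ c = F₂ ∘ ι ∘ c` twice therefore yields the second `x` derivative of
    -- `wf` plus the gradient of `wf` applied to the acceleration of `m ∘ c`, which is subtracted.
    set c : ℝ → ℝ × ℝ := fun s => p + s • (et, ex) with hc
    have hc0 : c 0 = p := by simp [hc]
    have hcs : ContDiffAt ℝ ∞ c 0 := by
      simp only [hc]; fun_prop
    have hcd : HasDerivAt c (et, ex) 0 := by
      have h := ((hasDerivAt_id (0 : ℝ)).smul_const (et, ex)).const_add p
      rwa [one_smul] at h
    have hιc : ContDiffAt ℝ ∞ (fun s => ι (c s)) 0 := by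
      refine ContDiffAt.comp (0 : ℝ) ?_ hcs
      rwa [hc0]
    have hιcd : deriv (fun s => ι (c s)) 0 = E := by
      have h := HasFDerivAt.comp_hasDerivAt (0 : ℝ) (l := ι) (l' := fderiv ℝ ι p)
        (by rw [hc0]; exact (hι.differentiableAt (by simp)).hasFDerivAt) hcd
      have h' : deriv (fun s => ι (c s)) 0 = _ := h.deriv
      have hab : ((et, ex) : ℝ × ℝ) = et • (1, 0) + ex • (0, 1) := by simp
      rw [h', hab, map_add, map_smul, map_smul, hτ, hχ, hE]
    have hsec : ∀ {F : JointSpace → ℝ}, ContDiffAt ℝ ∞ F (ι p) →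
        iteratedDeriv 2 (fun s => F (ι (c s))) 0 =
          fderiv ℝ (fderiv ℝ F) (ι p) E E + fderiv ℝ F (ι p) W := by
      intro F hF
      have h := iteratedDeriv_two_comp (F := F) (γ := fun s => ι (c s)) (s₀ := 0)
        (by rwa [hc0]) hιc
      rw [h, hιcd, hc0, hW]
    have hmc : ContDiffAt ℝ ∞ (fun s => m (c s)) 0 := by
      refine ContDiffAt.comp (g := m) (0 : ℝ) ?_ hcs
      rwa [hc0]
    have hmcd : deriv (fun s => m (c s)) 0 = (0, 1) := by
      have h := HasFDerivAt.comp_hasDerivAt (0 : ℝ) (l := m) (l' := fderiv ℝ m p)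
        (by rw [hc0]; exact (hms.differentiableAt (by simp)).hasFDerivAt) hcd
      rw [hme] at h
      exact h.deriv
    have hd2 : deriv (deriv fun s => m (c s)) 0 =
        (iteratedDeriv 2 (fun s => F₀ (ι (c s))) 0, iteratedDeriv 2 (fun s => F₁ (ι (c s))) 0) := by
      have hF : ∀ {F : JointSpace → ℝ}, ContDiffAt ℝ ∞ F (ι p) →
          ContDiffAt ℝ ∞ (fun s => F (ι (c s))) 0 := by
        intro F hF
        refine ContDiffAt.comp (0 : ℝ) ?_ hιc
        rwa [hc0]
      have hev : ∀ {f : ℝ → ℝ}, ContDiffAt ℝ ∞ f 0 → ∀ᶠ s in 𝓝 (0 : ℝ), DifferentiableAt ℝ f s := by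
        intro f hf
        filter_upwards [(hf.of_le (m := 1) (by norm_cast)).eventually (by simp)] with z hz
        exact hz.differentiableAt (by simp)
      have hder : ∀ {f : ℝ → ℝ}, ContDiffAt ℝ ∞ f 0 → DifferentiableAt ℝ (deriv f) 0 := by
        intro f hf
        have : ContDiffAt ℝ 1 (fderiv ℝ f) 0 := hf.fderiv_right (m := 1) (by norm_cast)
        exact (this.differentiableAt (by simp)).clm_apply (differentiableAt_const _)
      have h1 : (deriv fun s => m (c s)) =ᶠ[𝓝 0] fun s =>
          (deriv (fun s => F₀ (ι (c s))) s, deriv (fun s => F₁ (ι (c s))) s) := by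
        filter_upwards [hev (hF h₀), hev (hF h₁)] with s hs hs'
        exact (hs.hasDerivAt.prodMk hs'.hasDerivAt).deriv
      rw [h1.deriv_eq]
      simp only [iteratedDeriv_succ, iteratedDeriv_zero]
      exact ((hder (hF h₀)).hasDerivAt.prodMk (hder (hF h₁)).hasDerivAt).deriv
    have hfirst : iteratedDeriv 2 (fun s => wf (m (c s))) 0 =
        iteratedDeriv 2 (fun s => F₂ (ι (c s))) 0 := by
      refine Filter.EventuallyEq.iteratedDeriv_eq 2 ?_
      have : Filter.Tendsto c (𝓝 0) (𝓝 p) := by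
        have := hcs.continuousAt.tendsto; rwa [hc0] at this
      exact this.eventually hrel
    have hlast := iteratedDeriv_two_comp (F := wf) (γ := fun s => m (c s)) (s₀ := 0)
      (by rwa [hc0]) hmc
    rw [hfirst, hsec h₂, hmcd, hd2, hsec h₀, hsec h₁, hc0, hfab] at hlast
    rw [hvert]
    linarith

end GenBurgers

/-! ### Reduction of the equivalence condition to jets at a point -/

namespace GenBurgers

theorem eq_vec (z : JointSpace) : ![z 0, z 1, z 2, z 3, z 4, z 5] = z := by
  ext i; fin_cases i <;> rfl

theorem hasDerivAt_vec {f₀ f₁ f₂ f₃ f₄ f₅ : ℝ → ℝ} {a₀ a₁ a₂ a₃ a₄ a₅ s : ℝ}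
    (h₀ : HasDerivAt f₀ a₀ s) (h₁ : HasDerivAt f₁ a₁ s) (h₂ : HasDerivAt f₂ a₂ s)
    (h₃ : HasDerivAt f₃ a₃ s) (h₄ : HasDerivAt f₄ a₄ s) (h₅ : HasDerivAt f₅ a₅ s) :
    HasDerivAt (fun s => (![f₀ s, f₁ s, f₂ s, f₃ s, f₄ s, f₅ s] : JointSpace))
      ![a₀, a₁, a₂, a₃, a₄, a₅] s := by
  rw [hasDerivAt_pi]
  intro i
  fin_cases i
  exacts [h₀, h₁, h₂, h₃, h₄, h₅]

theorem contDiffAt_vec {E : Type*} [NormedAddCommGroup E] [NormedSpace ℝ E]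
    {f₀ f₁ f₂ f₃ f₄ f₅ : E → ℝ} {p : E}
    (h₀ : ContDiffAt ℝ ∞ f₀ p) (h₁ : ContDiffAt ℝ ∞ f₁ p) (h₂ : ContDiffAt ℝ ∞ f₂ p)
    (h₃ : ContDiffAt ℝ ∞ f₃ p) (h₄ : ContDiffAt ℝ ∞ f₄ p) (h₅ : ContDiffAt ℝ ∞ f₅ p) :
    ContDiffAt ℝ ∞ (fun s => (![f₀ s, f₁ s, f₂ s, f₃ s, f₄ s, f₅ s] : JointSpace)) p := by
  rw [contDiffAt_pi]
  intro i
  fin_cases i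
  exacts [h₀, h₁, h₂, h₃, h₄, h₅]

variable {Ω : Set JointSpace} {Φ : JointSpace → JointSpace} {z : JointSpace}

theorem contDiffOn_component (hΦ : IsGenEquivTransformation Ω Φ) (i : Fin 6) :
    ContDiffOn ℝ ∞ (fun y => Φ y i) Ω :=
  contDiffOn_pi.1 hΦ.smooth i

/-- A nowhere vanishing function with value `z 5` and derivative `r` at `z 0`. -/
noncomputable def expCoeff (z : JointSpace) (r s : ℝ) : ℝ := z 5 * Real.exp (r / z 5 * (s - z 0))

theorem expCoeff_self (z : JointSpace) (r : ℝ) : expCoeff z r (z 0) = z 5 := by simp [expCoeff]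

theorem contDiff_expCoeff (z : JointSpace) (r : ℝ) : ContDiff ℝ ∞ (expCoeff z r) := by
  unfold expCoeff; fun_prop

theorem hasDerivAt_expCoeff (z : JointSpace) (r s : ℝ) :
    HasDerivAt (expCoeff z r) (r / z 5 * expCoeff z r s) s := by
  have h1 : HasDerivAt (fun s => r / z 5 * (s - z 0)) (r / z 5) s := by
    simpa using ((hasDerivAt_id s).sub_const (z 0)).const_mul (r / z 5)
  refine (h1.exp.const_mul (z 5)).congr_deriv ?_
  unfold expCoeff
  ring

/-- The exponential test function lies in the class on the whole line, passes through `z` and has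
arbitrary slope `r` there. The constants produced by the class condition must be the values of `Φ`
at `z`. -/
theorem exists_of_expCoeff (hΩ : IsTransformationDomain Ω) (hΦ : IsGenEquivTransformation Ω Φ)
    (hz : z ∈ Ω) (r : ℝ) :
    ∃ (G : ℝ → ℝ) (J : Set ℝ), IsOpen J ∧ ContDiffOn ℝ ∞ G J ∧ (∀ s ∈ J, G s ≠ 0) ∧
      (∀ t x u : ℝ, ![t, x, u, z 3, z 4, expCoeff z r t] ∈ Ω →
        Φ ![t, x, u, z 3, z 4, expCoeff z r t] 3 = Φ z 3 ∧
        Φ ![t, x, u, z 3, z 4, expCoeff z r t] 4 = Φ z 4 ∧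
        Φ ![t, x, u, z 3, z 4, expCoeff z r t] 0 ∈ J ∧
        Φ ![t, x, u, z 3, z 4, expCoeff z r t] 5
          = G (Φ ![t, x, u, z 3, z 4, expCoeff z r t] 0)) ∧
      MapsEquation {p | ![p.1, p.2.1, p.2.2, z 3, z 4, expCoeff z r p.1] ∈ Ω}
        (fun t x u => Φ ![t, x, u, z 3, z 4, expCoeff z r t] 0)
        (fun t x u => Φ ![t, x, u, z 3, z 4, expCoeff z r t] 1)
        (fun t x u => Φ ![t, x, u, z 3, z 4, expCoeff z r t] 2)
        (z 3) (z 4) (expCoeff z r) (Φ z 3) (Φ z 4) G ∧ Φ z 3 ≠ 0 := by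
  have hin : InClass (z 3) (z 4) (expCoeff z r) Set.univ :=
    ⟨isOpen_univ, Set.ordConnected_univ, hΩ.n_ne_zero z hz, (contDiff_expCoeff z r).contDiffOn,
      fun t _ => mul_ne_zero (hΩ.g_ne_zero z hz) (Real.exp_ne_zero _)⟩
  obtain ⟨N, H, G, J, hNH, hconst, hmaps⟩ := hΦ.maps_class _ _ _ _ hin
  have hz' : ![z 0, z 1, z 2, z 3, z 4, expCoeff z r (z 0)] = z := by
    rw [expCoeff_self, eq_vec]
  have h := hconst (z 0) (z 1) (z 2) (Set.mem_univ _) (by rwa [hz'])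
  rw [hz'] at h
  obtain ⟨rfl, rfl, -⟩ := h
  exact ⟨G, J, hNH.isOpen, hNH.smooth, hNH.ne_zero, fun t x u => hconst t x u (Set.mem_univ _),
    by simpa using hmaps, hNH.exponent_ne_zero⟩

theorem exponent_ne_zero (hΩ : IsTransformationDomain Ω) (hΦ : IsGenEquivTransformation Ω Φ)
    (hz : z ∈ Ω) : Φ z 3 ≠ 0 := by
  obtain ⟨G, J, -, -, -, -, -, h⟩ := exists_of_expCoeff hΩ hΦ hz 0
  exact h

theorem coeff_ne_zero (hΩ : IsTransformationDomain Ω) (hΦ : IsGenEquivTransformation Ω Φ)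
    (hz : z ∈ Ω) : Φ z 5 ≠ 0 := by
  obtain ⟨G, J, -, -, h0, h, -, -⟩ := exists_of_expCoeff hΩ hΦ hz 0
  have hz' : ![z 0, z 1, z 2, z 3, z 4, expCoeff z 0 (z 0)] = z := by
    rw [expCoeff_self, eq_vec]
  have h := h (z 0) (z 1) (z 2) (by rwa [hz'])
  rw [hz'] at h
  rw [h.2.2.2]
  exact h0 _ h.2.2.1

/-- Along the graphs of the arbitrary elements, the components of `Φ` for `n` and `h` are constant
and the component for `g` is a function of the component for `t`. -/
theorem fderiv_component_of_tangent (hΩ : IsTransformationDomain Ω)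
    (hΦ : IsGenEquivTransformation Ω Φ) (hz : z ∈ Ω) (r : ℝ) :
    ∃ k : ℝ, ∀ V : JointSpace, V 3 = 0 → V 4 = 0 → V 5 = r * V 0 →
      fderiv ℝ (fun y => Φ y 3) z V = 0 ∧ fderiv ℝ (fun y => Φ y 4) z V = 0 ∧
        fderiv ℝ (fun y => Φ y 5) z V = k * fderiv ℝ (fun y => Φ y 0) z V := by
  obtain ⟨G, J, hJ, hG, -, hconst, -⟩ := exists_of_expCoeff hΩ hΦ hz r
  have hz' : ![z 0, z 1, z 2, z 3, z 4, expCoeff z r (z 0)] = z := by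
    rw [expCoeff_self, eq_vec]
  have h0 := hconst (z 0) (z 1) (z 2) (by rwa [hz'])
  rw [hz'] at h0
  refine ⟨deriv G (Φ z 0), fun V h3 h4 h5 => ?_⟩
  -- A curve with velocity `V` that stays over the graph of the test function; the condition on `V
  -- 5` makes this possible.
  set γ : ℝ → JointSpace := fun s =>
    ![z 0 + s * V 0, z 1 + s * V 1, z 2 + s * V 2, z 3, z 4, expCoeff z r (z 0 + s * V 0)] with hγ
  have hγ0 : γ 0 = z := by simp [hγ, expCoeff_self, eq_vec]
  have hlin : ∀ i, HasDerivAt (fun s : ℝ => z i + s * V i) (V i) 0 := fun i => by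
    simpa using ((hasDerivAt_id (0 : ℝ)).mul_const (V i)).const_add (z i)
  have hγd : HasDerivAt γ V 0 := by
    have hg : HasDerivAt (fun s => expCoeff z r (z 0 + s * V 0)) (V 5) 0 := by
      have h := (hasDerivAt_expCoeff z r (z 0 + 0 * V 0)).comp (0 : ℝ) (hlin 0)
      refine h.congr_deriv ?_
      simp only [zero_mul, add_zero, expCoeff_self, h5]
      field_simp [hΩ.g_ne_zero z hz]
    have h := hasDerivAt_vec (hlin 0) (hlin 1) (hlin 2) (hasDerivAt_const 0 (z 3))
      (hasDerivAt_const 0 (z 4)) hg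
    have hV : (![V 0, V 1, V 2, 0, 0, V 5] : JointSpace) = V := by
      conv_rhs => rw [← eq_vec V, h3, h4]
    rwa [hV] at h
  have hmem : ∀ᶠ s in 𝓝 (0 : ℝ), γ s ∈ Ω :=
    hγd.continuousAt.eventually (by rw [hγ0]; exact hΩ.isOpen.mem_nhds hz)
  have hcomp : ∀ i, HasDerivAt (fun s => Φ (γ s) i) (fderiv ℝ (fun y => Φ y i) z V) 0 := fun i => by
    refine HasFDerivAt.comp_hasDerivAt (0 : ℝ) (l := fun y => Φ y i) ?_ hγd
    rw [hγ0]
    exact (differentiableAt_of_mem hΩ.isOpen (contDiffOn_component hΦ i) hz).hasFDerivAt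
  refine ⟨?_, ?_, ?_⟩
  · refine (hcomp 3).unique ((hasDerivAt_const (0 : ℝ) (Φ z 3)).congr_of_eventuallyEq ?_)
    filter_upwards [hmem] with s hs using (hconst _ _ _ hs).1
  · refine (hcomp 4).unique ((hasDerivAt_const (0 : ℝ) (Φ z 4)).congr_of_eventuallyEq ?_)
    filter_upwards [hmem] with s hs using (hconst _ _ _ hs).2.1
  · have hGd : HasDerivAt G (deriv G (Φ z 0)) (Φ (γ 0) 0) := by
      rw [hγ0]
      exact ((hG.contDiffAt (hJ.mem_nhds h0.2.2.1)).differentiableAt (by simp)).hasDerivAt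
    refine (hcomp 5).unique ((hGd.comp (0 : ℝ) (hcomp 0)).congr_of_eventuallyEq ?_)
    filter_upwards [hmem] with s hs using (hconst _ _ _ hs).2.2.2

theorem eq_zero_of_fderiv_eq_zero (hΩ : IsTransformationDomain Ω)
    (hΦ : IsGenEquivTransformation Ω Φ) (hz : z ∈ Ω) {V : JointSpace}
    (h : ∀ i, fderiv ℝ (fun y => Φ y i) z V = 0) : V = 0 := by
  have hd : DifferentiableAt ℝ Φ z :=
    (hΦ.smooth.contDiffAt (hΩ.isOpen.mem_nhds hz)).differentiableAt (by simp)
  have h0 : fderiv ℝ Φ z V = 0 := by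
    ext i
    have hi : HasFDerivAt (fun y => Φ y i) _ z := hasFDerivAt_pi'.1 hd.hasFDerivAt i
    have h' := h i
    rw [hi.fderiv] at h'
    exact h'
  let e := (fderiv ℝ Φ z).toContinuousLinearEquivOfDetNeZero (hΦ.nondegenerate z hz)
  have : e V = e 0 := by
    rw [map_zero]
    exact h0
  exact e.injective this

/-- The Jacobian of the point transformation obtained by substituting arbitrary elements, where `r`
is the derivative of the function `g`, is nonzero. -/
theorem jacobian_ne_zero (hΩ : IsTransformationDomain Ω)
    (hΦ : IsGenEquivTransformation Ω Φ) (hz : z ∈ Ω) (r : ℝ) :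
    (pd 0 (fun y => Φ y 0) z + r * pd 5 (fun y => Φ y 0) z) *
        (pd 1 (fun y => Φ y 1) z * pd 2 (fun y => Φ y 2) z
          - pd 2 (fun y => Φ y 1) z * pd 1 (fun y => Φ y 2) z)
      - pd 1 (fun y => Φ y 0) z *
        ((pd 0 (fun y => Φ y 1) z + r * pd 5 (fun y => Φ y 1) z) * pd 2 (fun y => Φ y 2) z
          - pd 2 (fun y => Φ y 1) z * (pd 0 (fun y => Φ y 2) z + r * pd 5 (fun y => Φ y 2) z))
      + pd 2 (fun y => Φ y 0) z *
        ((pd 0 (fun y => Φ y 1) z + r * pd 5 (fun y => Φ y 1) z) * pd 1 (fun y => Φ y 2) z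
          - pd 1 (fun y => Φ y 1) z * (pd 0 (fun y => Φ y 2) z + r * pd 5 (fun y => Φ y 2) z))
      ≠ 0 := by
  set A : Matrix (Fin 3) (Fin 3) ℝ := Matrix.of ![
    ![pd 0 (fun y => Φ y 0) z + r * pd 5 (fun y => Φ y 0) z, pd 1 (fun y => Φ y 0) z,
      pd 2 (fun y => Φ y 0) z],
    ![pd 0 (fun y => Φ y 1) z + r * pd 5 (fun y => Φ y 1) z, pd 1 (fun y => Φ y 1) z,
      pd 2 (fun y => Φ y 1) z],
    ![pd 0 (fun y => Φ y 2) z + r * pd 5 (fun y => Φ y 2) z, pd 1 (fun y => Φ y 2) z,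
      pd 2 (fun y => Φ y 2) z]] with hA
  intro h
  have hdet : A.det = 0 := by
    rw [Matrix.det_fin_three, ← h]
    simp [hA]
    ring
  obtain ⟨v, hv0, hv⟩ := Matrix.exists_mulVec_eq_zero_iff.2 hdet
  have hv' : ∀ i, A.mulVec v i = 0 := fun i => by rw [hv]; rfl
  obtain ⟨k, hk⟩ := fderiv_component_of_tangent hΩ hΦ hz r
  -- The kernel vector of the 3 by 3 matrix, lifted to a direction tangent to the graph of `g`. Its
  -- images in `n` and `h` vanish, and its image in `g` is a multiple of that in `t`, so it lies in
  -- the kernel of the full differential.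
  set V : JointSpace := ![v 0, v 1, v 2, 0, 0, r * v 0] with hV
  have hVd : ∀ F : JointSpace → ℝ, fderiv ℝ F z V
      = v 0 * (pd 0 F z + r * pd 5 F z) + v 1 * pd 1 F z + v 2 * pd 2 F z := fun F => by
    rw [fderiv_eq_sum_pd, Fin.sum_univ_six]
    simp [hV]
    ring
  obtain ⟨k3, k4, k5⟩ := hk V rfl rfl rfl
  have e0 := hv' 0
  have e1 := hv' 1
  have e2 := hv' 2
  simp [hA, Matrix.mulVec, dotProduct, Fin.sum_univ_three] at e0 e1 e2
  have k0 : fderiv ℝ (fun y => Φ y 0) z V = 0 := by rw [hVd]; linear_combination e0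
  have hVz : V = 0 := by
    refine eq_zero_of_fderiv_eq_zero hΩ hΦ hz fun i => ?_
    fin_cases i
    · exact k0
    · simp only [Fin.mk_one]; rw [hVd]; linear_combination e1
    · simp only [Fin.reduceFinMk]; rw [hVd]; linear_combination e2
    · exact k3
    · exact k4
    · rw [k0, mul_zero] at k5; exact k5
  apply hv0
  ext i
  fin_cases i
  · exact congrFun hVz 0
  · exact congrFun hVz 1
  · exact congrFun hVz 2

/-- The condition on `Φ` at a point of the joint space in terms of the second-order jets: `a`, `b`,
`c`, `d` are the values of `u_t`, `u_x`, `u_xx`, `u_tt` and `r` is the value of `g_t`. -/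
theorem jet_condition (hΩ : IsTransformationDomain Ω) (hΦ : IsGenEquivTransformation Ω Φ)
    (hz : z ∈ Ω) (a b c d r : ℝ) {τ χ : JointSpace}
    (hτ : τ = ![1, 0, a, 0, 0, r]) (hχ : χ = ![0, 1, b, 0, 0, 0])
    {P Q R S Δ et ex wT wX : ℝ}
    (hP : P = fderiv ℝ (fun y => Φ y 0) z τ) (hQ : Q = fderiv ℝ (fun y => Φ y 0) z χ)
    (hR : R = fderiv ℝ (fun y => Φ y 1) z τ) (hS : S = fderiv ℝ (fun y => Φ y 1) z χ)
    (hΔ : Δ = P * S - Q * R) (hΔ0 : Δ ≠ 0)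
    (het : et = -Q / Δ) (hex : ex = P / Δ)
    (hwT : wT = (S * fderiv ℝ (fun y => Φ y 2) z τ - R * fderiv ℝ (fun y => Φ y 2) z χ) / Δ)
    (hwX : wX = (P * fderiv ℝ (fun y => Φ y 2) z χ - Q * fderiv ℝ (fun y => Φ y 2) z τ) / Δ)
    {E W : JointSpace} (hE : E = et • τ + ex • χ)
    (hW : W = ![0, 0, c * ex ^ 2 + d * et ^ 2, 0, 0, r ^ 2 / z 5 * et ^ 2]) :
    a + z 2 ^ z 3 * b + z 4 * z 2 = z 5 * c ↔
      wT + Φ z 2 ^ Φ z 3 * wX + Φ z 4 * Φ z 2 = Φ z 5 *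
        ((fderiv ℝ (fderiv ℝ fun y => Φ y 2) z E E + fderiv ℝ (fun y => Φ y 2) z W)
          - wT * (fderiv ℝ (fderiv ℝ fun y => Φ y 0) z E E + fderiv ℝ (fun y => Φ y 0) z W)
          - wX * (fderiv ℝ (fderiv ℝ fun y => Φ y 1) z E E
            + fderiv ℝ (fun y => Φ y 1) z W)) := by
  have h5 := hΩ.g_ne_zero z hz
  obtain ⟨G, J, hJ, hG, -, hconst, hmaps, -⟩ := exists_of_expCoeff hΩ hΦ hz r
  have hz' : ![z 0, z 1, z 2, z 3, z 4, expCoeff z r (z 0)] = z := by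
    rw [expCoeff_self, eq_vec]
  have h0 := hconst (z 0) (z 1) (z 2) (by rwa [hz'])
  rw [hz'] at h0
  -- A polynomial with the prescribed jet at `z`; no mixed term is needed, as `u_tt` and `u_xx`
  -- suffice for the splitting. The exponential `g` contributes `g_tt = r ^ 2 / z 5`, hence the last
  -- entry of `W`.
  set v : ℝ → ℝ → ℝ := fun s y => z 2 + a * (s - z 0) + b * (y - z 1)
      + c / 2 * (y - z 1) ^ 2 + d / 2 * (s - z 0) ^ 2 with hv
  have hvs : ∀ p, ContDiffAt ℝ ∞ (fun q : ℝ × ℝ => v q.1 q.2) p := fun p => by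
    simp only [hv]; fun_prop
  have hv0 : v (z 0) (z 1) = z 2 := by simp [hv]
  set ι : ℝ × ℝ → JointSpace := fun q => ![q.1, q.2, v q.1 q.2, z 3, z 4, expCoeff z r q.1] with hι
  have hι0 : ι (z 0, z 1) = z := by simp only [hι, hv0, hz']
  have hιs : ContDiffAt ℝ ∞ ι (z 0, z 1) :=
    contDiffAt_vec contDiffAt_fst contDiffAt_snd (hvs _) contDiffAt_const contDiffAt_const
      ((contDiff_expCoeff z r).contDiffAt.comp _ contDiffAt_fst)
  have hline : ∀ k l s : ℝ, HasDerivAt (fun s : ℝ => ι ((z 0, z 1) + s • (k, l)))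
      ![k, l, a * k + b * l + (c * l ^ 2 + d * k ^ 2) * s, 0, 0,
        r / z 5 * k * expCoeff z r (z 0 + s * k)] s := by
    intro k l s
    have hl : ∀ i k, HasDerivAt (fun s : ℝ => z i + s * k) k s := fun i k => by
      simpa using ((hasDerivAt_id s).mul_const k).const_add (z i)
    have hl' : ∀ k : ℝ, HasDerivAt (fun s : ℝ => s * k) k s := fun k => by
      simpa using (hasDerivAt_id s).mul_const k
    have hvd : HasDerivAt (fun s : ℝ => v (z 0 + s * k) (z 1 + s * l))
        (a * k + b * l + (c * l ^ 2 + d * k ^ 2) * s) s := by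
      simp only [hv, add_sub_cancel_left]
      have := (((((hl' k).const_mul a).const_add (z 2)).add ((hl' l).const_mul b)).add
        (((hl' l).pow 2).const_mul (c / 2))).add (((hl' k).pow 2).const_mul (d / 2))
      refine this.congr_deriv ?_
      simp
      ring
    have hgd : HasDerivAt (fun s : ℝ => expCoeff z r (z 0 + s * k))
        (r / z 5 * k * expCoeff z r (z 0 + s * k)) s := by
      refine ((hasDerivAt_expCoeff z r (z 0 + s * k)).comp s (hl 0 k)).congr_deriv ?_
      ring
    exact hasDerivAt_vec (hl 0 k) (hl 1 l) hvd (hasDerivAt_const _ _) (hasDerivAt_const _ _) hgd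
  have hdir : ∀ k l : ℝ, fderiv ℝ ι (z 0, z 1) (k, l) = ![k, l, a * k + b * l, 0, 0, r * k] := by
    intro k l
    have h1 : HasDerivAt (fun s : ℝ => (z 0, z 1) + s • (k, l)) (k, l) 0 := by
      have h := ((hasDerivAt_id (0 : ℝ)).smul_const (k, l)).const_add (z 0, z 1)
      rwa [one_smul] at h
    have h2 := HasFDerivAt.comp_hasDerivAt (0 : ℝ) (l := ι) (l' := fderiv ℝ ι (z 0, z 1))
      (by simpa using (hιs.differentiableAt (by simp)).hasFDerivAt) h1
    rw [h2.unique (hline k l 0)]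
    simp only [mul_zero, add_zero, zero_mul, expCoeff_self]
    congr 6
    field_simp
  have hWd : W = deriv (deriv fun s : ℝ => ι ((z 0, z 1) + s • (et, ex))) 0 := by
    have h1 : (deriv fun s : ℝ => ι ((z 0, z 1) + s • (et, ex))) = fun s => _ :=
      funext fun s => (hline et ex s).deriv
    have hl : HasDerivAt (fun s : ℝ => z 0 + s * et) et 0 := by
      simpa using ((hasDerivAt_id (0 : ℝ)).mul_const et).const_add (z 0)
    have hg2 : HasDerivAt (fun s : ℝ => r / z 5 * et * expCoeff z r (z 0 + s * et))
        (r ^ 2 / z 5 * et ^ 2) 0 := by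
      refine (((hasDerivAt_expCoeff z r (z 0 + 0 * et)).comp (0 : ℝ) hl).const_mul _).congr_deriv ?_
      simp only [zero_mul, add_zero, expCoeff_self]
      field_simp
    have hl2 : HasDerivAt (fun s : ℝ => a * et + b * ex + (c * ex ^ 2 + d * et ^ 2) * s)
        (c * ex ^ 2 + d * et ^ 2) 0 := by
      simpa using ((hasDerivAt_id (0 : ℝ)).const_mul (c * ex ^ 2 + d * et ^ 2)).const_add
        (a * et + b * ex)
    rw [h1, hW]
    exact (hasDerivAt_vec (hasDerivAt_const _ _) (hasDerivAt_const _ _) hl2 (hasDerivAt_const _ _)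
      (hasDerivAt_const _ _) hg2).deriv.symm
  have hF : ∀ i, ContDiffAt ℝ ∞ (fun y => Φ y i) z := fun i =>
    contDiffAt_of_mem hΩ.isOpen (contDiffOn_component hΦ i) hz
  obtain ⟨w, hw, hrel, hdT, hdX, hdXX⟩ := exists_transformed_graph hιs hι0
    (τ := τ) (χ := χ) (by rw [hdir, hτ]; simp) (by rw [hdir, hχ]; simp) (hF 0) (hF 1) (hF 2)
    hP hQ hR hS hΔ hΔ0 het hex hwT hwX hE hWd
  have hvec : ![z 0, z 1, v (z 0) (z 1), z 3, z 4, expCoeff z r (z 0)] = z := by rw [hv0, hz']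
  have key := hmaps v w (z 0) (z 1)
  simp only [Set.mem_ofPred_eq, hvec] at key
  have key := key hz (hvs _) hw hrel
  have hvt : deriv (fun s => v s (z 1)) (z 0) = a := by
    have h : HasDerivAt (fun s => v s (z 1)) _ (z 0) :=
      ((((((hasDerivAt_id (z 0)).sub_const (z 0)).const_mul a).const_add (z 2)).add_const
        (b * (z 1 - z 1))).add_const (c / 2 * (z 1 - z 1) ^ 2)).add
        ((((hasDerivAt_id (z 0)).sub_const (z 0)).pow 2).const_mul (d / 2))
    rw [h.deriv]
    simp
  have hvx : ∀ y, HasDerivAt (fun y => v (z 0) y) (b + c * (y - z 1)) y := fun y => by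
    have h : HasDerivAt (fun y => v (z 0) y) _ y :=
      (((((hasDerivAt_id y).sub_const (z 1)).const_mul b).const_add
        (z 2 + a * (z 0 - z 0))).add
        ((((hasDerivAt_id y).sub_const (z 1)).pow 2).const_mul (c / 2))).add_const
        (d / 2 * (z 0 - z 0) ^ 2)
    refine h.congr_deriv ?_
    simp
    ring
  have hvx1 : deriv (fun y => v (z 0) y) (z 1) = b := by rw [(hvx (z 1)).deriv]; simp
  have hvxx : iteratedDeriv 2 (fun y => v (z 0) y) (z 1) = c := by
    have : (deriv fun y => v (z 0) y) = fun y => b + c * (y - z 1) :=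
      funext fun y => (hvx y).deriv
    rw [iteratedDeriv_succ, iteratedDeriv_one, this]
    simp
  have hwval : w (Φ z 0) (Φ z 1) = Φ z 2 := by
    have := hrel.self_of_nhds
    rwa [hι0] at this
  unfold SatisfiesAt at key
  rw [hvt, hvx1, hvxx, hv0, expCoeff_self, hdT, hdX, hdXX, hwval, ← h0.2.2.2] at key
  exact key

end GenBurgers

/-! ### Splitting the jet condition: determining equations -/

namespace GenBurgers

variable {Ω : Set JointSpace} {Φ : JointSpace → JointSpace} {z : JointSpace}

theorem pd_mul {F F' : JointSpace → ℝ} (hF : DifferentiableAt ℝ F z)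
    (hF' : DifferentiableAt ℝ F' z) (i : Fin 6) :
    pd i (fun y => F y * F' y) z = F z * pd i F' z + F' z * pd i F z := by
  have h := (hF.hasFDerivAt.mul hF'.hasFDerivAt).fderiv
  simp only [pd]
  have h' : fderiv ℝ (fun y => F y * F' y) z = _ := h
  rw [h']
  simp

theorem pd_coord (i j : Fin 6) (z : JointSpace) :
    pd i (fun y => y j) z = (Pi.single i 1 : JointSpace) j := by
  have h : HasFDerivAt (fun y : JointSpace => y j)
      (ContinuousLinearMap.proj j : JointSpace →L[ℝ] ℝ) z := hasFDerivAt_apply j z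
  rw [pd, h.fderiv]
  rfl

theorem fderiv_timeVector (F : JointSpace → ℝ) (z : JointSpace) (a r : ℝ) :
    fderiv ℝ F z ![1, 0, a, 0, 0, r] = pd 0 F z + a * pd 2 F z + r * pd 5 F z := by
  rw [fderiv_eq_sum_pd, Fin.sum_univ_six]
  simp

theorem fderiv_spaceVector (F : JointSpace → ℝ) (z : JointSpace) (b : ℝ) :
    fderiv ℝ F z ![0, 1, b, 0, 0, 0] = pd 1 F z + b * pd 2 F z := by
  rw [fderiv_eq_sum_pd, Fin.sum_univ_six]
  simp

theorem fderiv_curvatureVector (F : JointSpace → ℝ) (z : JointSpace) (a r : ℝ) :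
    fderiv ℝ F z ![0, 0, a, 0, 0, r] = a * pd 2 F z + r * pd 5 F z := by
  rw [fderiv_eq_sum_pd, Fin.sum_univ_six]
  simp

/-- The directions `x` and `u`, and `t` with slope zero, are tangent to graphs of arbitrary
elements. The direction `g` is the difference of tangent vectors for slopes one and zero. -/
theorem pd_constants_eq_zero (hΩ : IsTransformationDomain Ω)
    (hΦ : IsGenEquivTransformation Ω Φ) (hz : z ∈ Ω) {i : Fin 6} (h3 : i ≠ 3) (h4 : i ≠ 4) :
    pd i (fun y => Φ y 3) z = 0 ∧ pd i (fun y => Φ y 4) z = 0 := by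
  obtain ⟨k, hk⟩ := fderiv_component_of_tangent hΩ hΦ hz 0
  obtain ⟨k', hk'⟩ := fderiv_component_of_tangent hΩ hΦ hz 1
  by_cases h5 : i = 5
  · subst h5
    obtain ⟨e3, e4, -⟩ := hk ![1, 0, 0, 0, 0, 0] rfl rfl (by simp)
    obtain ⟨e3', e4', -⟩ := hk' ![1, 0, 0, 0, 0, 1] rfl rfl (by simp)
    rw [fderiv_timeVector] at e3 e4 e3' e4'
    constructor <;> linarith
  · obtain ⟨e3, e4, -⟩ := hk (Pi.single i 1) (by simp [h3.symm])
      (by simp [h4.symm]) (by simp [Pi.single_apply, Ne.symm h5])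
    exact ⟨e3, e4⟩

/-- Selects values of `u_t` and `u_x` in general position. If it failed, then of `b = 0, 1, 2` two
would annihilate the same affine function of `b`, and its coefficients would vanish. -/
theorem exists_affine_ne_zero {m₁ m₂ m₃ q₁ q₂ : ℝ} (hm : ¬ (m₁ = 0 ∧ m₂ = 0 ∧ m₃ = 0))
    (hq : ¬ (q₁ = 0 ∧ q₂ = 0)) : ∃ a b : ℝ, q₁ + b * q₂ ≠ 0 ∧ m₁ + a * m₂ + b * m₃ ≠ 0 := by
  by_contra! h
  have key : ∀ b : ℝ, q₁ + b * q₂ = 0 ∨ (m₂ = 0 ∧ m₁ + b * m₃ = 0) := by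
    intro b
    by_cases hb : q₁ + b * q₂ = 0
    · exact Or.inl hb
    · have e0 := h 0 b hb
      have e1 := h 1 b hb
      exact Or.inr ⟨by linarith, by linarith⟩
  rcases key 0 with h0 | h0 <;> rcases key 1 with h1 | h1 <;> rcases key 2 with h2 | h2 <;>
    first
    | exact hq ⟨by linarith, by linarith⟩
    | exact hm ⟨by linarith, by linarith, by linarith⟩

/-- The component of `Φ` for `t` does not depend on `x` and `u`. -/
theorem pd_time_eq_zero (hΩ : IsTransformationDomain Ω) (hΦ : IsGenEquivTransformation Ω Φ)
    (hz : z ∈ Ω) : pd 1 (fun y => Φ y 0) z = 0 ∧ pd 2 (fun y => Φ y 0) z = 0 := by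
  by_contra hne
  have hK := jacobian_ne_zero hΩ hΦ hz 0
  simp only [zero_mul, add_zero] at hK
  set T₀ := pd 0 (fun y => Φ y 0) z
  set T₁ := pd 1 (fun y => Φ y 0) z
  set T₂ := pd 2 (fun y => Φ y 0) z
  set X₀ := pd 0 (fun y => Φ y 1) z
  set X₁ := pd 1 (fun y => Φ y 1) z
  set X₂ := pd 2 (fun y => Φ y 1) z
  set U₀ := pd 0 (fun y => Φ y 2) z
  set U₁ := pd 1 (fun y => Φ y 2) z
  set U₂ := pd 2 (fun y => Φ y 2) z
  -- The Jacobian, expanded along the row of `U`, is a combination of these minors, which are also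
  -- the coefficients of `Δ` as a polynomial in `a` and `b`.
  have hminors : ¬ (T₀ * X₁ - T₁ * X₀ = 0 ∧ T₂ * X₁ - T₁ * X₂ = 0 ∧ T₀ * X₂ - T₂ * X₀ = 0) := by
    rintro ⟨e1, e2, e3⟩
    apply hK
    linear_combination U₂ * e1 + U₀ * (-e2) - U₁ * e3
  obtain ⟨a, b, hq, hm⟩ := exists_affine_ne_zero hminors hne
  have h5 := hΩ.g_ne_zero z hz
  -- The value of `u_xx` for which the source equation holds, whatever `u_tt = d` is.
  set c := (a + z 2 ^ z 3 * b + z 4 * z 2) / z 5 with hc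
  have heq : a + z 2 ^ z 3 * b + z 4 * z 2 = z 5 * c := by rw [hc]; field_simp
  have hΔ0 : (T₀ + a * T₂) * (X₁ + b * X₂) - (T₁ + b * T₂) * (X₀ + a * X₂) ≠ 0 := by
    intro h0
    apply hm
    linear_combination h0
  have key := fun d : ℝ => (jet_condition hΩ hΦ hz a b c d 0 rfl rfl
    (P := T₀ + a * T₂) (Q := T₁ + b * T₂) (R := X₀ + a * X₂) (S := X₁ + b * X₂)
    (by rw [fderiv_timeVector]; ring) (by rw [fderiv_spaceVector])
    (by rw [fderiv_timeVector]; ring) (by rw [fderiv_spaceVector])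
    rfl hΔ0 rfl rfl rfl rfl rfl rfl).1 heq
  simp only [fderiv_curvatureVector, fderiv_timeVector, fderiv_spaceVector] at key
  set Δ := (T₀ + a * T₂) * (X₁ + b * X₂) - (T₁ + b * T₂) * (X₀ + a * X₂) with hΔ
  have k0 := key 0
  have k1 := key 1
  set wT := ((X₁ + b * X₂) * (U₀ + a * U₂ + 0 * pd 5 (fun y => Φ y 2) z)
    - (X₀ + a * X₂) * (U₁ + b * U₂)) / Δ with hwT
  set wX := ((T₀ + a * T₂) * (U₁ + b * U₂)
    - (T₁ + b * T₂) * (U₀ + a * U₂ + 0 * pd 5 (fun y => Φ y 2) z)) / Δ with hwX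
  set q := -(T₁ + b * T₂) / Δ with hqd
  have hq0 : q ≠ 0 := div_ne_zero (neg_ne_zero.2 hq) hΔ0
  -- Comparing `d = 0` with `d = 1` isolates the coefficient of `u_tt` in the target equation. Its
  -- last factor times `Δ` is the Jacobian, a contradiction.
  have hdiff : Φ z 5 * (q ^ 2 * (U₂ - wT * T₂ - wX * X₂)) = 0 := by
    linear_combination k0 - k1
  have hG := coeff_ne_zero hΩ hΦ hz
  have hκ : U₂ - wT * T₂ - wX * X₂ = 0 := by
    simpa [hG, hq0] using hdiff
  apply hK
  have h1 : wT * Δ = (X₁ + b * X₂) * (U₀ + a * U₂) - (X₀ + a * X₂) * (U₁ + b * U₂) := by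
    rw [hwT]; field_simp; ring
  have h2 : wX * Δ = (T₀ + a * T₂) * (U₁ + b * U₂) - (T₁ + b * T₂) * (U₀ + a * U₂) := by
    rw [hwX]; field_simp; ring
  linear_combination Δ * hκ + T₂ * h1 + X₂ * h2 - U₂ * hΔ

/-- The component of `Φ` for `t` does not depend on `g` and has a nonzero derivative with respect
to `t`. -/
theorem pd_time_ne_zero (hΩ : IsTransformationDomain Ω) (hΦ : IsGenEquivTransformation Ω Φ)
    (hz : z ∈ Ω) : pd 5 (fun y => Φ y 0) z = 0 ∧ pd 0 (fun y => Φ y 0) z ≠ 0 ∧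
      pd 1 (fun y => Φ y 1) z * pd 2 (fun y => Φ y 2) z
          - pd 2 (fun y => Φ y 1) z * pd 1 (fun y => Φ y 2) z ≠ 0 := by
  obtain ⟨h1, h2⟩ := pd_time_eq_zero hΩ hΦ hz
  have hK := jacobian_ne_zero hΩ hΦ hz
  simp only [h1, h2, zero_mul, sub_zero, add_zero, mul_ne_zero_iff] at hK
  have h5 : pd 5 (fun y => Φ y 0) z = 0 := by
    by_contra h5
    -- This slope of `g` would annihilate the total time derivative `T_t + r T_g`.
    refine (hK (-pd 0 (fun y => Φ y 0) z / pd 5 (fun y => Φ y 0) z)).1 ?_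
    field_simp
    ring
  refine ⟨h5, ?_, (hK 0).2⟩
  simpa using (hK 0).1

/-- For the case `k = et = 0`: once the new time depends on neither `x` nor `u`, the preimage of the
new `x` direction has no time component. -/
theorem fderiv_fderiv_spaceVector {F : JointSpace → ℝ} (hΩ : IsOpen Ω)
    (hF : ContDiffOn ℝ ∞ F Ω) (hz : z ∈ Ω) (k l b : ℝ) (τ : JointSpace) (hk : k = 0) :
    fderiv ℝ (fderiv ℝ F) z (k • τ + l • ![0, 1, b, 0, 0, 0])
        (k • τ + l • ![0, 1, b, 0, 0, 0]) =
      l ^ 2 * (pd 1 (pd 1 F) z + 2 * b * pd 1 (pd 2 F) z + b ^ 2 * pd 2 (pd 2 F) z) := by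
  subst hk
  simp only [zero_smul, zero_add, map_smul, smul_apply, smul_eq_mul]
  rw [fderiv_fderiv_eq_sum (contDiffAt_of_mem hΩ hF hz)]
  simp only [Fin.sum_univ_six]
  simp [pd_comm hΩ hF hz 2 1]
  ring

/-- The jet condition for time transformations. -/
theorem reduced_jet_condition (hΩ : IsTransformationDomain Ω) (hΦ : IsGenEquivTransformation Ω Φ)
    (hz : z ∈ Ω) {a b c r S : ℝ} (hS : S = pd 1 (fun y => Φ y 1) z + b * pd 2 (fun y => Φ y 1) z)
    (hS0 : S ≠ 0) {wX : ℝ}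
    (hwX : wX = (pd 1 (fun y => Φ y 2) z + b * pd 2 (fun y => Φ y 2) z) / S)
    (heq : a + z 2 ^ z 3 * b + z 4 * z 2 = z 5 * c) :
    (pd 0 (fun y => Φ y 2) z + a * pd 2 (fun y => Φ y 2) z + r * pd 5 (fun y => Φ y 2) z
        - (pd 0 (fun y => Φ y 1) z + a * pd 2 (fun y => Φ y 1) z + r * pd 5 (fun y => Φ y 1) z)
          * wX) / pd 0 (fun y => Φ y 0) z
      + Φ z 2 ^ Φ z 3 * wX + Φ z 4 * Φ z 2
    = Φ z 5 * (((pd 1 (pd 1 fun y => Φ y 2) z + 2 * b * pd 1 (pd 2 fun y => Φ y 2) z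
        + b ^ 2 * pd 2 (pd 2 fun y => Φ y 2) z + c * pd 2 (fun y => Φ y 2) z)
      - wX * (pd 1 (pd 1 fun y => Φ y 1) z + 2 * b * pd 1 (pd 2 fun y => Φ y 1) z
        + b ^ 2 * pd 2 (pd 2 fun y => Φ y 1) z + c * pd 2 (fun y => Φ y 1) z)) / S ^ 2) := by
  have hT := fun y (hy : y ∈ Ω) => pd_time_eq_zero hΩ hΦ hy
  obtain ⟨hT5, hT0, -⟩ := pd_time_ne_zero hΩ hΦ hz
  obtain ⟨hT1, hT2⟩ := hT z hz
  have hP : fderiv ℝ (fun y => Φ y 0) z ![1, 0, a, 0, 0, r] = pd 0 (fun y => Φ y 0) z := by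
    rw [fderiv_timeVector, hT2, hT5]; ring
  have hQ : fderiv ℝ (fun y => Φ y 0) z ![0, 1, b, 0, 0, 0] = 0 := by
    rw [fderiv_spaceVector, hT1, hT2]; ring
  have hS' : fderiv ℝ (fun y => Φ y 1) z ![0, 1, b, 0, 0, 0] = S := by
    rw [fderiv_spaceVector, hS]
  have key := (jet_condition hΩ hΦ hz a b c 0 r rfl rfl rfl rfl rfl rfl rfl
    (by rw [hP, hQ, hS']; simp [hT0, hS0]) rfl rfl rfl rfl rfl rfl).1 heq
  simp only [hP, hQ, hS', zero_mul, sub_zero, neg_zero, zero_div] at key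
  have hsm := fun i => contDiffOn_component hΦ i
  rw [fderiv_fderiv_spaceVector hΩ.isOpen (hsm 0) hz _ _ _ _ rfl,
    fderiv_fderiv_spaceVector hΩ.isOpen (hsm 1) hz _ _ _ _ rfl,
    fderiv_fderiv_spaceVector hΩ.isOpen (hsm 2) hz _ _ _ _ rfl] at key
  simp only [fderiv_curvatureVector, fderiv_timeVector, fderiv_spaceVector,
    pd_eq_zero hΩ.isOpen (fun y hy => (hT y hy).1) hz,
    pd_eq_zero hΩ.isOpen (fun y hy => (hT y hy).2) hz, hT2] at key
  have hwX' : pd 0 (fun y => Φ y 0) z * (pd 1 (fun y => Φ y 2) z + b * pd 2 (fun y => Φ y 2) z)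
      / (pd 0 (fun y => Φ y 0) z * S) = wX := by
    rw [hwX, mul_div_mul_left _ _ hT0]
  have hwXS : pd 1 (fun y => Φ y 2) z + b * pd 2 (fun y => Φ y 2) z = wX * S := by
    rw [hwX]; field_simp
  rw [hwX', hwXS] at key
  have e1 : pd 0 (fun y => Φ y 0) z / (pd 0 (fun y => Φ y 0) z * S) = 1 / S := by
    field_simp
  rw [e1] at key
  generalize pd 0 (fun y => Φ y 0) z = T₀ at *
  have e2 : ∀ p q : ℝ, (S * p - q * (wX * S)) / (T₀ * S) = (p - q * wX) / T₀ := by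
    intro p q; field_simp
  rw [e2] at key
  rw [key]
  field_simp
  ring

/-- The component of `Φ` for `x` does not depend on `u`. -/
theorem pd_space (hΩ : IsTransformationDomain Ω) (hΦ : IsGenEquivTransformation Ω Φ)
    (hz : z ∈ Ω) : pd 2 (fun y => Φ y 1) z = 0 ∧ pd 1 (fun y => Φ y 1) z ≠ 0 ∧
      pd 2 (fun y => Φ y 2) z ≠ 0 ∧
      z 5 * pd 1 (fun y => Φ y 1) z ^ 2 = Φ z 5 * pd 0 (fun y => Φ y 0) z := by
  obtain ⟨-, hT0, hK⟩ := pd_time_ne_zero hΩ hΦ hz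
  have h5 := hΩ.g_ne_zero z hz
  have key : ∀ b : ℝ, pd 1 (fun y => Φ y 1) z + b * pd 2 (fun y => Φ y 1) z ≠ 0 →
      z 5 * (pd 1 (fun y => Φ y 1) z + b * pd 2 (fun y => Φ y 1) z) ^ 2
        = Φ z 5 * pd 0 (fun y => Φ y 0) z := by
    intro b hb
    -- `u_xx` is moved from 0 to 1 while `u_t` compensates to keep the source equation true; the
    -- difference isolates the coefficient of `u_xx`.
    have k0 := reduced_jet_condition hΩ hΦ hz (a := -(z 2 ^ z 3 * b + z 4 * z 2)) (c := 0) (r := 0)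
      rfl hb rfl (by ring)
    have k1 := reduced_jet_condition hΩ hΦ hz (a := z 5 - (z 2 ^ z 3 * b + z 4 * z 2)) (c := 1)
      (r := 0) rfl hb rfl (by ring)
    generalize pd 0 (fun y => Φ y 0) z = T₀ at *
    generalize pd 1 (fun y => Φ y 1) z = X₁ at *
    generalize pd 2 (fun y => Φ y 1) z = X₂ at *
    generalize pd 1 (fun y => Φ y 2) z = U₁ at *
    generalize pd 2 (fun y => Φ y 2) z = U₂ at *
    have hS : ∃ S, S = X₁ + b * X₂ := ⟨_, rfl⟩
    obtain ⟨S, hS⟩ := hS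
    rw [← hS] at hb k0 k1 ⊢
    have hwX : ∃ w, w = (U₁ + b * U₂) / S := ⟨_, rfl⟩
    obtain ⟨w, hw⟩ := hwX
    rw [← hw] at k0 k1
    have hd : z 5 * (U₂ - w * X₂) / T₀ = Φ z 5 * ((U₂ - w * X₂) / S ^ 2) := by
      linear_combination k1 - k0
    have hne : U₂ - w * X₂ ≠ 0 := by
      intro h0
      apply hK
      have : w * S = U₁ + b * U₂ := by rw [hw]; field_simp
      linear_combination S * h0 + X₂ * this - U₂ * hS
    field_simp at hd
    linear_combination hd
  have hX2 : pd 2 (fun y => Φ y 1) z = 0 := by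
    by_contra hX2
    -- If `X_u ≠ 0`, a suitable `u_x` gives the total derivative `X_x + b X_u` any value `s`. Since
    -- `g s²` would have to be the same for `s = 1` and `s = 2`, this is impossible.
    have e : ∀ s : ℝ, pd 1 (fun y => Φ y 1) z + (s - pd 1 (fun y => Φ y 1) z)
        / pd 2 (fun y => Φ y 1) z * pd 2 (fun y => Φ y 1) z = s := fun s => by
      field_simp; ring
    have k1 := key ((1 - pd 1 (fun y => Φ y 1) z) / pd 2 (fun y => Φ y 1) z) (by rw [e]; norm_num)
    have k2 := key ((2 - pd 1 (fun y => Φ y 1) z) / pd 2 (fun y => Φ y 1) z) (by rw [e]; norm_num)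
    rw [e] at k1 k2
    apply h5
    linarith
  rw [hX2, zero_mul, sub_zero, mul_ne_zero_iff] at hK
  refine ⟨hX2, hK.1, hK.2, ?_⟩
  have := key 0 (by simpa using hK.1)
  simpa using this

/-- Differentiate `g X_x² = G T_t` in `x`: `G` depends on `x` only through the new time, so the
right side has zero derivative. -/
theorem pd_pd_space_eq_zero (hΩ : IsTransformationDomain Ω) (hΦ : IsGenEquivTransformation Ω Φ)
    (hz : z ∈ Ω) : pd 1 (pd 1 fun y => Φ y 1) z = 0 := by
  have ho := hΩ.isOpen
  have hsm := fun i => contDiffOn_component hΦ i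
  have h := pd_congr ho (fun y hy => (pd_space hΩ hΦ hy).2.2.2) hz 1
  have hX1 : DifferentiableAt ℝ (pd 1 fun y => Φ y 1) z :=
    differentiableAt_of_mem ho (contDiffOn_pd ho (hsm 1) 1) hz
  have hT0 : DifferentiableAt ℝ (pd 0 fun y => Φ y 0) z :=
    differentiableAt_of_mem ho (contDiffOn_pd ho (hsm 0) 0) hz
  have hG : pd 1 (fun y => Φ y 5) z = 0 := by
    obtain ⟨k, hk⟩ := fderiv_component_of_tangent hΩ hΦ hz 0
    have := (hk (Pi.single 1 1) (by simp) (by simp) (by simp)).2.2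
    have h1 := (pd_time_eq_zero hΩ hΦ hz).1
    rw [pd] at h1
    rw [pd, this, h1, mul_zero]
  have hT01 := pd_pd_eq_zero ho (hsm 0) (fun y hy => (pd_time_eq_zero hΩ hΦ hy).1) hz 0
  simp only [pow_two] at h
  rw [pd_mul (F' := fun y => pd 1 (fun y => Φ y 1) y * pd 1 (fun y => Φ y 1) y) (by fun_prop)
    (hX1.mul hX1), pd_mul hX1 hX1,
    pd_mul (differentiableAt_of_mem ho (hsm 5) hz) hT0, hG, hT01, pd_coord] at h
  have h5 := hΩ.g_ne_zero z hz
  have hX := (pd_space hΩ hΦ hz).2.1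
  have h' : z 5 * (2 * pd 1 (fun y => Φ y 1) z * pd 1 (pd 1 fun y => Φ y 1) z) = 0 := by
    simp at h
    simp only [mul_eq_zero] at h ⊢
    tauto
  simpa [h5, hX] using h'

/-- The determining equations obtained by splitting the jet condition. -/
theorem determining_equations (hΩ : IsTransformationDomain Ω)
    (hΦ : IsGenEquivTransformation Ω Φ) (hz : z ∈ Ω) :
    pd 2 (pd 2 fun y => Φ y 2) z = 0 ∧ pd 5 (fun y => Φ y 2) z = 0 ∧
      pd 5 (fun y => Φ y 1) z = 0 ∧
      Φ z 2 ^ Φ z 3 * pd 0 (fun y => Φ y 0) z * pd 2 (fun y => Φ y 2) z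
        - (z 2 ^ z 3 * pd 1 (fun y => Φ y 1) z + pd 0 (fun y => Φ y 1) z)
          * pd 2 (fun y => Φ y 2) z
        = 2 * z 5 * pd 1 (fun y => Φ y 1) z * pd 1 (pd 2 fun y => Φ y 2) z ∧
      (pd 0 (fun y => Φ y 2) z - z 4 * z 2 * pd 2 (fun y => Φ y 2) z
        - pd 0 (fun y => Φ y 1) z * (pd 1 (fun y => Φ y 2) z / pd 1 (fun y => Φ y 1) z))
          / pd 0 (fun y => Φ y 0) z
        + Φ z 2 ^ Φ z 3 * (pd 1 (fun y => Φ y 2) z / pd 1 (fun y => Φ y 1) z) + Φ z 4 * Φ z 2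
        = Φ z 5 * (pd 1 (pd 1 fun y => Φ y 2) z / pd 1 (fun y => Φ y 1) z ^ 2) := by
  obtain ⟨hX2, hX1, hU2, hgG⟩ := pd_space hΩ hΦ hz
  obtain ⟨-, hT0, -⟩ := pd_time_ne_zero hΩ hΦ hz
  have hX11 := pd_pd_space_eq_zero hΩ hΦ hz
  have hX12 := pd_eq_zero hΩ.isOpen (fun y hy => (pd_space hΩ hΦ hy).1) hz 1
  have hX22 := pd_eq_zero hΩ.isOpen (fun y hy => (pd_space hΩ hΦ hy).1) hz 2
  have key := fun b r : ℝ => reduced_jet_condition hΩ hΦ hz (b := b)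
    (a := -(z 2 ^ z 3 * b + z 4 * z 2)) (c := 0) (r := r)
    rfl (by simpa [hX2] using hX1) rfl (by ring)
  simp only [hX2, hX11, hX12, hX22, mul_zero, add_zero, sub_zero, zero_mul] at key
  generalize pd 0 (fun y => Φ y 0) z = T₀ at *
  generalize pd 0 (fun y => Φ y 1) z = X₀ at *
  generalize pd 1 (fun y => Φ y 1) z = X₁ at *
  generalize pd 5 (fun y => Φ y 1) z = X₅ at *
  generalize pd 0 (fun y => Φ y 2) z = U₀ at *
  generalize pd 1 (fun y => Φ y 2) z = U₁ at *
  generalize pd 2 (fun y => Φ y 2) z = U₂ at *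
  generalize pd 5 (fun y => Φ y 2) z = U₅ at *
  generalize pd 1 (pd 1 fun y => Φ y 2) z = U₁₁ at *
  generalize pd 1 (pd 2 fun y => Φ y 2) z = U₁₂ at *
  generalize pd 2 (pd 2 fun y => Φ y 2) z = U₂₂ at *
  generalize Φ z 2 ^ Φ z 3 = p at *
  generalize z 2 ^ z 3 = q at *
  have hG : Φ z 5 = z 5 * X₁ ^ 2 / T₀ := by rw [hgG]; field_simp
  have hgz := hΩ.g_ne_zero z hz
  have hC := key 0 0
  simp only [mul_zero, zero_mul, add_zero, zero_add] at hC
  have key' : ∀ b r : ℝ, (U₀ - (q * b + z 4 * z 2) * U₂ + r * U₅) * X₁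
      - (X₀ + r * X₅) * (U₁ + b * U₂) + p * (U₁ + b * U₂) * T₀ + Φ z 4 * Φ z 2 * T₀ * X₁
      = z 5 * X₁ * (U₁₁ + 2 * b * U₁₂ + b ^ 2 * U₂₂) := by
    intro b r
    have := key b r
    rw [hG] at this
    field_simp at this
    linear_combination this
  -- The identity is polynomial in `b = u_x` and `r = g_t`; these five samples recover the
  -- coefficients of `b²`, `b r`, `r` and `b`.
  have k00 := key' 0 0
  have k10 := key' 1 0
  have km0 := key' (-1) 0
  have k01 := key' 0 1
  have k11 := key' 1 1
  have hU22 : U₂₂ = 0 := by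
    have : z 5 * X₁ * U₂₂ = 0 := by linear_combination k00 - (k10 + km0) / 2
    simpa [hgz, hX1] using this
  have hX5 : X₅ = 0 := by
    have : X₅ * U₂ = 0 := by linear_combination (k10 - k00) - (k11 - k01)
    simpa [hU2] using this
  have hU5 : U₅ = 0 := by
    have : U₅ * X₁ = 0 := by linear_combination k01 - k00 + U₁ * hX5
    simpa [hX1] using this
  refine ⟨hU22, hU5, hX5, ?_, ?_⟩
  · linear_combination (k10 - km0) / 2
  · linear_combination hC

end GenBurgers

/-! ### The exponent and linearity in the dependent variable -/

namespace GenBurgers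

variable {Ω : Set JointSpace} {Φ : JointSpace → JointSpace} {z : JointSpace}

/-- Proportional powers of affine functions, up to an additive constant. -/
theorem exponent_eq_of_rpow_affine {N n U V u A B q : ℝ} (hN : N ≠ 0) (hV : V ≠ 0)
    (hA : A ≠ 0) (hU : 0 < U) (hu : 0 < u)
    (h : ∀ᶠ s : ℝ in 𝓝 0, (U + s * V) ^ N * A = (u + s) ^ n * B + q) :
    N = n ∧ (n ≠ 1 → U = u * V) := by
  have hlU : ∀ s : ℝ, HasDerivAt (fun s => U + s * V) V s := fun s => by
    simpa using ((hasDerivAt_id s).mul_const V).const_add U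
  have hlu : ∀ s : ℝ, HasDerivAt (fun s => u + s) 1 s := fun s => by
    simpa using (hasDerivAt_id s).const_add u
  have hpos : ∀ᶠ s : ℝ in 𝓝 0, 0 < U + s * V ∧ 0 < u + s := by
    have h1 : ContinuousAt (fun s => U + s * V) 0 := (hlU 0).continuousAt
    have h2 : ContinuousAt (fun s => u + s) 0 := (hlu 0).continuousAt
    exact (h1.eventually_const_lt (by simpa using hU)).and
      (h2.eventually_const_lt (by simpa using hu))
  -- One derivative removes `q`. Comparing logarithmic derivatives of the two sides then removes
  -- `A`, `B` and the powers, leaving the affine identity `e2`; its slope gives `N = n` and its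
  -- constant term gives proportionality.
  have e1 : ∀ᶠ s : ℝ in 𝓝 0, V * N * (U + s * V) ^ (N - 1) * A = n * (u + s) ^ (n - 1) * B := by
    filter_upwards [h.eventually_nhds, hpos] with s hs hp
    have d1 := ((hlU s).rpow_const (p := N) (Or.inl hp.1.ne')).mul_const A
    have d2 := (((hlu s).rpow_const (p := n) (Or.inl hp.2.ne')).mul_const B).add_const q
    have := d1.unique (d2.congr_of_eventuallyEq hs)
    rw [this]; ring
  have e2 : ∀ᶠ s : ℝ in 𝓝 0, (N - 1) * V * (u + s) = (n - 1) * (U + s * V) := by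
    filter_upwards [e1.eventually_nhds, hpos] with s hs hp
    have d1 := (((hlU s).rpow_const (p := N - 1) (Or.inl hp.1.ne')).const_mul (V * N)).mul_const A
    have d2 := (((hlu s).rpow_const (p := n - 1) (Or.inl hp.2.ne')).const_mul n).mul_const B
    have hd := d1.unique (d2.congr_of_eventuallyEq hs)
    have h0 := hs.self_of_nhds
    have p1 : (U + s * V) ^ (N - 1) = (U + s * V) ^ (N - 1 - 1) * (U + s * V) := by
      rw [Real.rpow_sub_one hp.1.ne' (N - 1)]
      field_simp [hp.1.ne']
    have p2 : (u + s) ^ (n - 1) = (u + s) ^ (n - 1 - 1) * (u + s) := by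
      rw [Real.rpow_sub_one hp.2.ne' (n - 1)]
      field_simp [hp.2.ne']
    have hne : V * N * (U + s * V) ^ (N - 1 - 1) * A ≠ 0 :=
      mul_ne_zero (mul_ne_zero (mul_ne_zero hV hN) (Real.rpow_pos_of_pos hp.1 _).ne') hA
    rw [p1, p2] at h0
    apply mul_left_cancel₀ hne
    linear_combination (u + s) * hd - (n - 1) * h0
  have e3 : (N - 1) * V * (u + 0) = (n - 1) * (U + 0 * V) := e2.self_of_nhds
  have e4 := ((hlu 0).const_mul ((N - 1) * V)).unique
    (((hlU 0).const_mul (n - 1)).congr_of_eventuallyEq e2)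
  have hNn : N = n := by
    have : V * (N - n) = 0 := by linear_combination e4
    have := (mul_eq_zero.1 this).resolve_left hV
    linarith
  refine ⟨hNn, fun hn => ?_⟩
  subst hNn
  have : (N - 1) * (U - u * V) = 0 := by linear_combination -e3
  have := (mul_eq_zero.1 this).resolve_left (sub_ne_zero.2 hn)
  linarith

/-- In the fourth determining equation every term is independent of `g` except the explicit factor
`z 5` on the right. Evaluating at two nearby values of `g` kills `U_xu`. -/
theorem exponent_relation (hΩ : IsTransformationDomain Ω) (hΦ : IsGenEquivTransformation Ω Φ)
    (hz : z ∈ Ω) : pd 1 (pd 2 fun y => Φ y 2) z = 0 ∧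
      Φ z 2 ^ Φ z 3 * pd 0 (fun y => Φ y 0) z
        = z 2 ^ z 3 * pd 1 (fun y => Φ y 1) z + pd 0 (fun y => Φ y 1) z := by
  have ho := hΩ.isOpen
  have hsm := fun i => contDiffOn_component hΦ i
  have hsm1 := fun i j => contDiffOn_pd ho (hsm i) j
  have hdet := fun y (hy : y ∈ Ω) => determining_equations hΩ hΦ hy
  have hT5 := fun y (hy : y ∈ Ω) => (pd_time_ne_zero hΩ hΦ hy).1
  have hX5 := fun y (hy : y ∈ Ω) => (hdet y hy).2.2.1
  have hU5 := fun y (hy : y ∈ Ω) => (hdet y hy).2.1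
  have hU25 := fun y (hy : y ∈ Ω) => pd_pd_eq_zero ho (hsm 2) hU5 hy 2
  have hev : ∀ᶠ s : ℝ in 𝓝[≠] 0, s ≠ 0 := eventually_mem_nhdsWithin
  obtain ⟨s, hs0, hmem, e1, e2, e3, e4, e5, e6, e7⟩ := (hev.and
    ((eventually_nhdsWithin_of_eventually_nhds (s := {0}ᶜ) (eventually_mem_line ho hz _)).and <|
    (eventually_nhdsWithin_of_eventually_nhds (eventually_eq_of_pd_eq_zero ho (hsm 2) hU5 hz)).and <|
    (eventually_nhdsWithin_of_eventually_nhds (eventually_eq_of_pd_eq_zero ho (hsm 3)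
      (fun y hy => (pd_constants_eq_zero hΩ hΦ hy (i := 5) (by decide) (by decide)).1) hz)).and <|
    (eventually_nhdsWithin_of_eventually_nhds (eventually_eq_of_pd_eq_zero ho (hsm1 0 0)
      (fun y hy => pd_pd_eq_zero ho (hsm 0) hT5 hy 0) hz)).and <|
    (eventually_nhdsWithin_of_eventually_nhds (eventually_eq_of_pd_eq_zero ho (hsm1 1 0)
      (fun y hy => pd_pd_eq_zero ho (hsm 1) hX5 hy 0) hz)).and <|
    (eventually_nhdsWithin_of_eventually_nhds (eventually_eq_of_pd_eq_zero ho (hsm1 1 1)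
      (fun y hy => pd_pd_eq_zero ho (hsm 1) hX5 hy 1) hz)).and <|
    (eventually_nhdsWithin_of_eventually_nhds (eventually_eq_of_pd_eq_zero ho (hsm1 2 2)
      hU25 hz)).and <|
    (eventually_nhdsWithin_of_eventually_nhds (eventually_eq_of_pd_eq_zero ho
      (contDiffOn_pd ho (hsm1 2 2) 1)
      (fun y hy => pd_pd_eq_zero ho (hsm1 2 2) hU25 hy 1) hz)))).exists
  have h0 := (hdet z hz).2.2.2.1
  have h1 := (hdet _ hmem).2.2.2.1
  rw [e1, e2, e3, e4, e5, e6, e7] at h1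
  have c2 : (z + s • (Pi.single 5 1 : JointSpace)) 2 = z 2 := by simp
  have c3 : (z + s • (Pi.single 5 1 : JointSpace)) 3 = z 3 := by simp
  have c5 : (z + s • (Pi.single 5 1 : JointSpace)) 5 = z 5 + s := by simp
  rw [c2, c3, c5] at h1
  obtain ⟨-, hX1, hU2, -⟩ := pd_space hΩ hΦ hz
  have hU12 : pd 1 (pd 2 fun y => Φ y 2) z = 0 := by
    have : s * (pd 1 (fun y => Φ y 1) z * pd 1 (pd 2 fun y => Φ y 2) z) = 0 := by
      linear_combination (h0 - h1) / 2
    simpa [hs0, hX1] using this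
  refine ⟨hU12, ?_⟩
  rw [hU12] at h0
  apply mul_right_cancel₀ hU2
  linear_combination h0

/-- Along a `u` line `U` is affine, since `U_uu = 0`, while `N`, `T_t`, `X_x` and `X_t` are
constant. Thus `U^N T_t = u^n X_x + X_t` compares powers of two affine functions. For `n = 1` a
shift of `u` is still possible. -/
theorem exponent_eq (hΩ : IsTransformationDomain Ω) (hΦ : IsGenEquivTransformation Ω Φ)
    (hz : z ∈ Ω) : Φ z 3 = z 3 ∧ (z 3 ≠ 1 → Φ z 2 = z 2 * pd 2 (fun y => Φ y 2) z) := by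
  have ho := hΩ.isOpen
  have hsm := fun i => contDiffOn_component hΦ i
  have hsm1 := fun i j => contDiffOn_pd ho (hsm i) j
  have hT2 := fun y (hy : y ∈ Ω) => (pd_time_eq_zero hΩ hΦ hy).2
  have hX2 := fun y (hy : y ∈ Ω) => (pd_space hΩ hΦ hy).1
  obtain ⟨-, hT0, -⟩ := pd_time_ne_zero hΩ hΦ hz
  obtain ⟨-, hX1, hU2, -⟩ := pd_space hΩ hΦ hz
  refine exponent_eq_of_rpow_affine (exponent_ne_zero hΩ hΦ hz) hU2 hT0 (hΦ.u_pos z hz)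
    (hΩ.u_pos z hz) (B := pd 1 (fun y => Φ y 1) z) (q := pd 0 (fun y => Φ y 1) z) ?_
  have hFsm : ContDiffOn ℝ ∞ (fun y => Φ y 2 - pd 2 (fun y => Φ y 2) z * y 2) Ω :=
    (hsm 2).sub (by fun_prop)
  have hlin : ∀ᶠ s : ℝ in 𝓝 0, Φ (z + s • Pi.single 2 1) 2
      = Φ z 2 + s * pd 2 (fun y => Φ y 2) z := by
    obtain ⟨ε, hε, hball⟩ := Metric.isOpen_iff.1 ho z hz
    filter_upwards [eventually_mem_line Metric.isOpen_ball (Metric.mem_ball_self hε)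
      (Pi.single 2 1)] with s hs
    -- `U_u` equals its value at `z` only along the `u` line, so the mean value argument for `U -
    -- U_u(z) u` runs on the convex set where the ball meets that line.
    have hc : ∀ w ∈ Metric.ball z ε ∩ {w | ∃ s : ℝ, w = z + s • Pi.single 2 1},
        pd 2 (fun y => Φ y 2) w = pd 2 (fun y => Φ y 2) z := by
      rintro w ⟨hw, s, rfl⟩
      refine eq_of_fderiv_eq_zero (convex_ball z ε)
        (fun w hw => differentiableAt_of_mem ho (hsm1 2 2) (hball hw)) (Metric.mem_ball_self hε) hw
        fun w hw => ?_
      rw [add_sub_cancel_left, map_smul]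
      exact (congrArg _ (determining_equations hΩ hΦ (hball hw)).1).trans (smul_zero s)
    have hconv : Convex ℝ (Metric.ball z ε ∩ {w | ∃ s : ℝ, w = z + s • Pi.single 2 1}) := by
      refine (convex_ball z ε).inter ?_
      rintro _ ⟨p, rfl⟩ _ ⟨q, rfl⟩ a b - - hab
      refine ⟨a * p + b * q, ?_⟩
      have hb : b = 1 - a := by linarith
      subst hb
      module
    have := eq_of_fderiv_eq_zero (F := fun y => Φ y 2 - pd 2 (fun y => Φ y 2) z * y 2) hconv
      (fun w hw => differentiableAt_of_mem ho hFsm (hball hw.1))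
      (z := z) (z' := z + s • Pi.single 2 1)
      ⟨Metric.mem_ball_self hε, 0, by simp⟩ ⟨hs, s, rfl⟩ fun w hw => ?_
    · simp at this
      linarith
    · rw [add_sub_cancel_left, map_smul]
      have hd := ((differentiableAt_of_mem ho (hsm 2) (hball hw.1)).hasFDerivAt.sub
        ((hasFDerivAt_apply (𝕜 := ℝ) (2 : Fin 6) w).const_mul
          (pd 2 (fun y => Φ y 2) z))).fderiv
      have hd' : fderiv ℝ (fun y => Φ y 2 - pd 2 (fun y => Φ y 2) z * y 2) w = _ := hd
      rw [hd']
      have := hc w hw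
      rw [pd] at this
      simp [this]
  filter_upwards [hlin, eventually_mem_line ho hz (Pi.single 2 1),
    eventually_eq_of_pd_eq_zero ho (hsm 3)
      (fun y hy => (pd_constants_eq_zero hΩ hΦ hy (i := 2) (by decide) (by decide)).1) hz,
    eventually_eq_of_pd_eq_zero ho (hsm1 0 0) (fun y hy => pd_pd_eq_zero ho (hsm 0) hT2 hy 0) hz,
    eventually_eq_of_pd_eq_zero ho (hsm1 1 0) (fun y hy => pd_pd_eq_zero ho (hsm 1) hX2 hy 0) hz,
    eventually_eq_of_pd_eq_zero ho (hsm1 1 1) (fun y hy => pd_pd_eq_zero ho (hsm 1) hX2 hy 1) hz]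
    with s e1 hmem e2 e3 e4 e5
  have := (exponent_relation hΩ hΦ hmem).2
  rw [e1, e2, e3, e4, e5] at this
  simpa using this

/-- The component of `Φ` for `u` is linear in `u`. -/
theorem dependent_eq (hΩ : IsTransformationDomain Ω) (hΦ : IsGenEquivTransformation Ω Φ)
    (hz : z ∈ Ω) : Φ z 2 = z 2 * pd 2 (fun y => Φ y 2) z := by
  have ho := hΩ.isOpen
  have hsm := contDiffOn_component hΦ 2
  by_contra hne
  have hc : ContinuousAt (fun y => Φ y 2 - y 2 * pd 2 (fun y => Φ y 2) y) z := by
    have h1 := (differentiableAt_of_mem ho hsm hz).continuousAt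
    have h2 := (differentiableAt_of_mem ho (contDiffOn_pd ho hsm 2) hz).continuousAt
    have h3 : ContinuousAt (fun y : JointSpace => y 2) z := continuousAt_apply 2 z
    exact h1.sub (h3.mul h2)
  -- Failure of linearity is an open condition and so would persist after a small change of `n`; but
  -- it is only possible at `n = 1`.
  have hl : ContinuousAt (fun s : ℝ => z + s • (Pi.single 3 1 : JointSpace)) 0 := by fun_prop
  have h1 : ∀ᶠ s : ℝ in 𝓝 0, z + s • (Pi.single 3 1 : JointSpace) ∈ Ω :=
    eventually_mem_line ho hz _
  have h2 : ∀ᶠ s : ℝ in 𝓝 0, Φ (z + s • Pi.single 3 1) 2 - (z + s • Pi.single 3 1 : JointSpace) 2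
      * pd 2 (fun y => Φ y 2) (z + s • Pi.single 3 1) ≠ 0 := by
    refine hl.eventually (p := fun w => Φ w 2 - w 2 * pd 2 (fun y => Φ y 2) w ≠ 0) ?_
    simp only [zero_smul, add_zero]
    exact hc.eventually_ne (sub_ne_zero.2 hne)
  obtain ⟨s, ⟨hs, hs'⟩, hs0⟩ := ((eventually_nhdsWithin_of_eventually_nhds (s := {0}ᶜ)
    (h1.and h2)).and eventually_mem_nhdsWithin).exists
  have hall : ∀ y ∈ Ω, Φ y 2 - y 2 * pd 2 (fun y => Φ y 2) y ≠ 0 → y 3 = 1 := by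
    intro y hy hne
    by_contra h
    exact hne (sub_eq_zero.2 ((exponent_eq hΩ hΦ hy).2 h))
  have e1 := hall _ hs hs'
  have e2 := hall z hz (sub_ne_zero.2 hne)
  apply hs0
  simpa [e2] using e1

/-- The final form of the determining equations. -/
theorem reduced_determining_equations (hΩ : IsTransformationDomain Ω)
    (hΦ : IsGenEquivTransformation Ω Φ) (hz : z ∈ Ω) :
    pd 0 (fun y => Φ y 1) z = 0 ∧
      pd 2 (fun y => Φ y 2) z ^ z 3 * pd 0 (fun y => Φ y 0) z = pd 1 (fun y => Φ y 1) z ∧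
      pd 1 (fun y => Φ y 2) z = 0 ∧
      pd 0 (fun y => Φ y 2) z = (z 4 - Φ z 4 * pd 0 (fun y => Φ y 0) z) * Φ z 2 ∧
      0 < pd 2 (fun y => Φ y 2) z := by
  have ho := hΩ.isOpen
  have hsm := fun i => contDiffOn_component hΦ i
  have hsm1 := fun i j => contDiffOn_pd ho (hsm i) j
  have hT2 := fun y (hy : y ∈ Ω) => (pd_time_eq_zero hΩ hΦ hy).2
  have hX2 := fun y (hy : y ∈ Ω) => (pd_space hΩ hΦ hy).1
  have hU22 := fun y (hy : y ∈ Ω) => (determining_equations hΩ hΦ hy).1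
  have hpos : ∀ y ∈ Ω, 0 < pd 2 (fun y => Φ y 2) y := by
    intro y hy
    have h1 := hΦ.u_pos y hy
    rw [dependent_eq hΩ hΦ hy] at h1
    exact pos_of_mul_pos_right h1 (hΩ.u_pos y hy).le
  have hrel : ∀ y ∈ Ω, y 2 ^ y 3 * (pd 2 (fun y => Φ y 2) y ^ y 3 * pd 0 (fun y => Φ y 0) y
      - pd 1 (fun y => Φ y 1) y) = pd 0 (fun y => Φ y 1) y := by
    intro y hy
    have h1 := (exponent_relation hΩ hΦ hy).2
    rw [(exponent_eq hΩ hΦ hy).1, dependent_eq hΩ hΦ hy,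
      Real.mul_rpow (hΩ.u_pos y hy).le (hpos y hy).le] at h1
    linear_combination h1
  -- In `hrel` the bracket and the right side do not depend on `u`, whereas `u^n` takes different
  -- values at different positive `u`; hence the bracket vanishes.
  have hzero : pd 2 (fun y => Φ y 2) z ^ z 3 * pd 0 (fun y => Φ y 0) z
      - pd 1 (fun y => Φ y 1) z = 0 := by
    obtain ⟨s, hs0, hmem, e1, e2, e3, e4⟩ := ((eventually_mem_nhdsWithin (s := {(0 : ℝ)}ᶜ)).and
      ((eventually_nhdsWithin_of_eventually_nhds (eventually_mem_line ho hz (Pi.single 2 1))).and <|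
      (eventually_nhdsWithin_of_eventually_nhds (eventually_eq_of_pd_eq_zero ho (hsm1 2 2)
        hU22 hz)).and <|
      (eventually_nhdsWithin_of_eventually_nhds (eventually_eq_of_pd_eq_zero ho (hsm1 0 0)
        (fun y hy => pd_pd_eq_zero ho (hsm 0) hT2 hy 0) hz)).and <|
      (eventually_nhdsWithin_of_eventually_nhds (eventually_eq_of_pd_eq_zero ho (hsm1 1 0)
        (fun y hy => pd_pd_eq_zero ho (hsm 1) hX2 hy 0) hz)).and <|
      (eventually_nhdsWithin_of_eventually_nhds (eventually_eq_of_pd_eq_zero ho (hsm1 1 1)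
        (fun y hy => pd_pd_eq_zero ho (hsm 1) hX2 hy 1) hz)))).exists
    have h1 := hrel _ hmem
    have hp := hΩ.u_pos _ hmem
    have c2 : (z + s • (Pi.single 2 1 : JointSpace)) 2 = z 2 + s := by simp
    have c3 : (z + s • (Pi.single 2 1 : JointSpace)) 3 = z 3 := by simp
    rw [c2] at hp
    rw [e1, e2, e3, e4, c2, c3, ← hrel z hz] at h1
    by_contra hne
    have h2 := mul_right_cancel₀ hne h1
    have h3 := (Real.rpow_left_inj hp.le (hΩ.u_pos z hz).le (hΩ.n_ne_zero z hz)).1 h2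
    apply hs0
    simpa using h3
  have hX0 : pd 0 (fun y => Φ y 1) z = 0 := by rw [← hrel z hz, hzero, mul_zero]
  have hU1 : ∀ y ∈ Ω, pd 1 (fun y => Φ y 2) y = 0 := by
    intro y hy
    rw [pd_congr ho (F' := fun y => y 2 * pd 2 (fun y => Φ y 2) y)
      (fun y hy => dependent_eq hΩ hΦ hy) hy,
      pd_mul (by fun_prop) (differentiableAt_of_mem ho (hsm1 2 2) hy), pd_coord]
    rw [(exponent_relation hΩ hΦ hy).1]
    simp
  refine ⟨hX0, by linarith, hU1 z hz, ?_, hpos z hz⟩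
  have h := (determining_equations hΩ hΦ hz).2.2.2.2
  have hT0 := (pd_time_ne_zero hΩ hΦ hz).2.1
  rw [pd_eq_zero ho hU1 hz, hU1 z hz, hX0] at h
  simp only [zero_div, mul_zero, sub_zero, add_zero] at h
  field_simp at h
  rw [dependent_eq hΩ hΦ hz] at h ⊢
  linear_combination h

end GenBurgers

/-! ### The exponential antiderivative and the time relation -/

namespace GenBurgers

/-- The antiderivative of `t ↦ exp (a t)` that vanishes at zero. -/
noncomputable def expInt (a t : ℝ) : ℝ := if a = 0 then t else (Real.exp (a * t) - 1) / a

theorem hasDerivAt_expInt (a t : ℝ) : HasDerivAt (expInt a) (Real.exp (a * t)) t := by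
  by_cases ha : a = 0
  · have : expInt a = id := by funext s; simp [expInt, ha]
    rw [this]
    simpa [ha] using hasDerivAt_id t
  · have : expInt a = fun s => (Real.exp (a * s) - 1) / a := by funext s; simp [expInt, ha]
    rw [this]
    have h1 : HasDerivAt (fun s => a * s) a t := by simpa using (hasDerivAt_id t).const_mul a
    refine ((h1.exp.sub_const 1).div_const a).congr_deriv ?_
    field_simp

theorem strictMono_expInt (a : ℝ) : StrictMono (expInt a) :=
  strictMono_of_hasDerivAt_pos (hasDerivAt_expInt a) fun _ => Real.exp_pos _

theorem contDiff_dslope_exp : ContDiff ℝ ∞ (dslope Real.exp 0) := by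
  rw [contDiff_iff_contDiffAt]
  intro y
  by_cases hy : y = 0
  · subst hy
    obtain ⟨p, hp⟩ : AnalyticAt ℝ Real.exp 0 := analyticAt_rexp
    exact (hp.has_fpower_series_dslope_fslope.analyticAt).contDiffAt
  · have h : dslope Real.exp 0 =ᶠ[𝓝 y] fun y => (y - 0)⁻¹ * (Real.exp y - Real.exp 0) := by
      filter_upwards [isOpen_ne.mem_nhds hy] with w hw
      rw [dslope_of_ne _ hw, slope_def_field]
      ring
    refine ContDiffAt.congr_of_eventuallyEq ?_ h
    refine ContDiffAt.mul (ContDiffAt.inv (by fun_prop) (by simpa using hy)) (by fun_prop)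

theorem expInt_eq (a t : ℝ) : expInt a t = t * dslope Real.exp 0 (a * t) := by
  by_cases ha : a = 0
  · simp [expInt, ha]
  · by_cases ht : t = 0
    · simp [expInt, ht]
    · rw [dslope_of_ne _ (mul_ne_zero ha ht), slope_def_field, expInt, if_neg ha]
      simp
      field_simp

/-- Joint smoothness across `a = 0` holds because `expInt a t` is `t` times the analytic
continuation of `(exp y - 1) / y` at `y = a t`. It lets `h` and the new damping coefficient pass
through zero. -/
theorem contDiff_expInt : ContDiff ℝ ∞ fun p : ℝ × ℝ => expInt p.1 p.2 := by
  simp only [expInt_eq]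
  exact contDiff_snd.mul (contDiff_dslope_exp.comp (contDiff_fst.mul contDiff_snd))

theorem timeRelation_iff {n h H α β t T : ℝ} (hn : n ≠ 0) :
    TimeRelation n h H α β t T ↔ expInt (-n * H) T = α * expInt (-n * h) t + β := by
  unfold TimeRelation expInt
  by_cases hh : h = 0 <;> by_cases hH : H = 0 <;> simp [hh, hH, hn]

/-! ### Integration of the determining equations along slices -/

section Slices

variable {Ω : Set JointSpace} {Φ : JointSpace → JointSpace} {z : JointSpace}

theorem pd_expInt {A B : JointSpace → ℝ} (hΩ : IsOpen Ω) (hA : ContDiffOn ℝ ∞ A Ω)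
    (hB : ContDiffOn ℝ ∞ B Ω) {i : Fin 6} (h : ∀ y ∈ Ω, pd i A y = 0) (hz : z ∈ Ω) :
    pd i (fun y => expInt (A y) (B y)) z = Real.exp (A z * B z) * pd i B z := by
  have hF : ContDiffOn ℝ ∞ (fun y => expInt (A y) (B y)) Ω :=
    contDiff_expInt.comp_contDiffOn (hA.prodMk hB)
  have h1 := hasDerivAt_line (differentiableAt_of_mem hΩ hF hz) (Pi.single i 1) (s := 0) (y := z)
    (by simp)
  have h2 := hasDerivAt_line (differentiableAt_of_mem hΩ hB hz) (Pi.single i 1) (s := 0) (y := z)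
    (by simp)
  have h3 := (hasDerivAt_expInt (A z) (B (z + (0 : ℝ) • Pi.single i 1))).comp (0 : ℝ) h2
  have h4 := h1.unique (h3.congr_of_eventuallyEq (by
    filter_upwards [eventually_eq_of_pd_eq_zero hΩ hA h hz] with s hs
    simp [hs]))
  rw [pd, h4]
  simp [pd]

/-- A smooth function with vanishing derivatives with respect to `t`, `x`, `u`, `g` is a smooth
function of `(n, h)`. -/
theorem exists_eq_of_pd_eq_zero (hΩ : IsTransformationDomain Ω) {F : JointSpace → ℝ}
    (hF : ContDiffOn ℝ ∞ F Ω)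
    (h : ∀ y ∈ Ω, pd 0 F y = 0 ∧ pd 1 F y = 0 ∧ pd 2 F y = 0 ∧ pd 5 F y = 0) :
    ∃ f : ℝ × ℝ → ℝ, ContDiffOn ℝ ∞ f (constants Ω) ∧ ∀ z ∈ Ω, f (z 3, z 4) = F z := by
  classical
  have hex : ∀ p : ℝ × ℝ, ∃ c : ℝ, ∀ z ∈ Ω, (z 3, z 4) = p → F z = c := by
    intro p
    by_cases hp : ∃ z ∈ Ω, (z 3, z 4) = p
    · obtain ⟨z, hz, rfl⟩ := hp
      refine ⟨F z, fun y hy hyz => ?_⟩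
      rw [Prod.mk.injEq] at hyz
      exact eq_of_mem_slice hΩ (fun w hw => differentiableAt_of_mem hΩ.isOpen hF hw) h hy hz
        hyz.1 hyz.2
    · exact ⟨0, fun z hz hzp => absurd ⟨z, hz, hzp⟩ hp⟩
  choose f hf using hex
  refine ⟨f, ?_, fun z hz => (hf _ z hz rfl).symm⟩
  rintro _ ⟨z, hz, rfl⟩
  refine ContDiffAt.contDiffWithinAt ?_
  -- Near `(z 3, z 4)` the function `f` is `F` along this section, which varies only the constants.
  have hsec : ContDiffAt ℝ ∞ (fun p : ℝ × ℝ => (![z 0, z 1, z 2, p.1, p.2, z 5] : JointSpace))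
      (z 3, z 4) :=
    contDiffAt_vec contDiffAt_const contDiffAt_const contDiffAt_const contDiffAt_fst contDiffAt_snd
      contDiffAt_const
  have hz' : ![z 0, z 1, z 2, z 3, z 4, z 5] ∈ Ω := by rwa [eq_vec]
  refine (ContDiffAt.comp (g := F) (z 3, z 4) (contDiffAt_of_mem hΩ.isOpen hF hz')
    hsec).congr_of_eventuallyEq ?_
  filter_upwards [hsec.continuousAt.eventually (hΩ.isOpen.mem_nhds hz')] with p hp
  exact (hf p _ hp rfl).symm

theorem pd_sub {F F' : JointSpace → ℝ} (hF : DifferentiableAt ℝ F z)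
    (hF' : DifferentiableAt ℝ F' z) (i : Fin 6) :
    pd i (fun y => F y - F' y) z = pd i F z - pd i F' z := by
  have h : fderiv ℝ (fun y => F y - F' y) z = _ := (hF.hasFDerivAt.sub hF'.hasFDerivAt).fderiv
  rw [pd, h]
  rfl

theorem pd_exp {F : JointSpace → ℝ} (hF : DifferentiableAt ℝ F z) (i : Fin 6) :
    pd i (fun y => Real.exp (F y)) z = Real.exp (F z) * pd i F z := by
  rw [pd, hF.hasFDerivAt.exp.fderiv]
  simp [pd]

/-- A function of the constants `(n, h)` does not depend on the other variables. -/
theorem pd_comp_constants (hΩ : IsOpen Ω) {f : ℝ × ℝ → ℝ} {F : JointSpace → ℝ}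
    (hF : ContDiffOn ℝ ∞ F Ω) (h : ∀ z ∈ Ω, F z = f (z 3, z 4)) (hz : z ∈ Ω) {i : Fin 6}
    (h3 : i ≠ 3) (h4 : i ≠ 4) : pd i F z = 0 := by
  have h1 := hasDerivAt_line (differentiableAt_of_mem hΩ hF hz) (Pi.single i 1) (s := 0) (y := z)
    (by simp)
  refine h1.unique ((hasDerivAt_const (0 : ℝ) (F z)).congr_of_eventuallyEq ?_)
  filter_upwards [eventually_mem_line hΩ hz (Pi.single i 1)] with s hs
  rw [h _ hs, h _ hz]
  simp [h3.symm, h4.symm]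

/-- A vector sent by the differential of `Φ` to the `h` direction has no `n` component, because `N =
n`. As `H` depends only on `(n, h)`, its `h` derivative has to produce the value 1. -/
theorem deriv_damping_ne_zero (hΩ : IsTransformationDomain Ω)
    (hΦ : IsGenEquivTransformation Ω Φ) {H : ℝ × ℝ → ℝ}
    (hH : ∀ z ∈ Ω, H (z 3, z 4) = Φ z 4) (hz : z ∈ Ω) :
    deriv (fun k => H (z 3, k)) (z 4) ≠ 0 := by
  have ho := hΩ.isOpen
  have hsm := fun i => contDiffOn_component hΦ i
  have hd4 := differentiableAt_of_mem ho (hsm 4) hz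
  have hpd : deriv (fun k => H (z 3, k)) (z 4) = pd 4 (fun y => Φ y 4) z := by
    have h1 : HasDerivAt (fun s => Φ (z + s • Pi.single 4 1) 4) (pd 4 (fun y => Φ y 4) z)
        (z 4 - z 4) := hasDerivAt_line hd4 (Pi.single 4 1) (y := z) (by simp)
    have h2 := h1.comp_sub_const (z 4) (z 4)
    refine (h2.congr_of_eventuallyEq ?_).deriv
    have hc : ContinuousAt (fun k => k - z 4) (z 4) := by fun_prop
    have hev := hc.eventually (p := fun s => z + s • (Pi.single 4 1 : JointSpace) ∈ Ω)
      (by simp only [sub_self]; exact eventually_mem_line ho hz _)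
    filter_upwards [hev] with k hk
    rw [← hH _ hk]
    simp
  rw [hpd]
  intro h0
  have hd : DifferentiableAt ℝ Φ z :=
    (hΦ.smooth.contDiffAt (ho.mem_nhds hz)).differentiableAt (by simp)
  let e := (fderiv ℝ Φ z).toContinuousLinearEquivOfDetNeZero (hΦ.nondegenerate z hz)
  obtain ⟨V, hV⟩ := e.surjective (Pi.single 4 1)
  have hV' : fderiv ℝ Φ z V = Pi.single 4 1 := hV
  have hcomp : ∀ i, fderiv ℝ (fun y => Φ y i) z V = (Pi.single 4 1 : JointSpace) i := by
    intro i
    have hi : HasFDerivAt (fun y => Φ y i) _ z := hasFDerivAt_pi'.1 hd.hasFDerivAt i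
    rw [← hV', hi.fderiv]
    rfl
  have hV3 : V 3 = 0 := by
    have h1 := hcomp 3
    rw [fderiv_eq_sum_pd] at h1
    simp only [pd_congr ho (fun y hy => (exponent_eq hΩ hΦ hy).1) hz, pd_coord] at h1
    simpa [Pi.single_apply] using h1
  have h1 := hcomp 4
  have hp := fun (i : Fin 6) h3 h4 => (pd_constants_eq_zero hΩ hΦ hz (i := i) h3 h4).2
  rw [fderiv_eq_sum_pd, Fin.sum_univ_six, hp 0 (by decide) (by decide), hp 1 (by decide) (by decide),
    hp 2 (by decide) (by decide), hp 5 (by decide) (by decide), h0, hV3] at h1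
  simp at h1

/-- Each parameter is a first integral of the determining equations: a combination of `Φ`, its
derivatives and the coordinates whose derivatives in `t`, `x`, `u`, `g` all vanish. -/
theorem exists_parameters (hΩ : IsTransformationDomain Ω) (hΦ : IsGenEquivTransformation Ω Φ) :
    ∃ H α β δ₀ δ₁ : ℝ × ℝ → ℝ,
      ContDiffOn ℝ ∞ H (constants Ω) ∧ ContDiffOn ℝ ∞ α (constants Ω) ∧
      ContDiffOn ℝ ∞ β (constants Ω) ∧ ContDiffOn ℝ ∞ δ₀ (constants Ω) ∧
      ContDiffOn ℝ ∞ δ₁ (constants Ω) ∧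
      (∀ n h : ℝ, (n, h) ∈ constants Ω →
        deriv (fun k => H (n, k)) h ≠ 0 ∧ 0 < α (n, h) * δ₁ (n, h)) ∧
      ∀ t x u n h g : ℝ, ![t, x, u, n, h, g] ∈ Ω →
        ∃ T : ℝ, TimeRelation n h (H (n, h)) (α (n, h)) (β (n, h)) t T ∧
          Φ ![t, x, u, n, h, g] =
            ![T,
              δ₁ (n, h) * x + δ₀ (n, h),
              (δ₁ (n, h) / α (n, h)) ^ (1 / n) * Real.exp (h * t - H (n, h) * T) * u,
              n,
              H (n, h),
              δ₁ (n, h) ^ 2 / α (n, h) * Real.exp (n * h * t - n * H (n, h) * T) * g] := by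
  have ho := hΩ.isOpen
  have hsm := fun i => contDiffOn_component hΦ i
  have hsm1 := fun i j => contDiffOn_pd ho (hsm i) j
  have hd := fun i y (hy : y ∈ Ω) => differentiableAt_of_mem ho (hsm i) hy
  have hd1 := fun i j y (hy : y ∈ Ω) => differentiableAt_of_mem ho (hsm1 i j) hy
  have hdc : ∀ (i : Fin 6) (y : JointSpace), DifferentiableAt ℝ (fun y : JointSpace => y i) y :=
    fun i y => differentiableAt_apply i y
  have hred := fun y (hy : y ∈ Ω) => reduced_determining_equations hΩ hΦ hy
  have hdet := fun y (hy : y ∈ Ω) => determining_equations hΩ hΦ hy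
  have hT1 := fun y (hy : y ∈ Ω) => (pd_time_eq_zero hΩ hΦ hy).1
  have hT2 := fun y (hy : y ∈ Ω) => (pd_time_eq_zero hΩ hΦ hy).2
  have hT5 := fun y (hy : y ∈ Ω) => (pd_time_ne_zero hΩ hΦ hy).1
  have hX0 := fun y (hy : y ∈ Ω) => (hred y hy).1
  have hX2 := fun y (hy : y ∈ Ω) => (pd_space hΩ hΦ hy).1
  have hX5 := fun y (hy : y ∈ Ω) => (hdet y hy).2.2.1
  have hU1 := fun y (hy : y ∈ Ω) => (hred y hy).2.2.1
  have hU5 := fun y (hy : y ∈ Ω) => (hdet y hy).2.1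
  have hHc := fun (i : Fin 6) h3 h4 y (hy : y ∈ Ω) =>
    (pd_constants_eq_zero hΩ hΦ hy (i := i) h3 h4).2
  have hX1c : ∀ y ∈ Ω, pd 0 (pd 1 fun y => Φ y 1) y = 0 ∧ pd 1 (pd 1 fun y => Φ y 1) y = 0 ∧
      pd 2 (pd 1 fun y => Φ y 1) y = 0 ∧ pd 5 (pd 1 fun y => Φ y 1) y = 0 := fun y hy =>
    ⟨pd_pd_eq_zero ho (hsm 1) hX0 hy 1, pd_pd_space_eq_zero hΩ hΦ hy,
      pd_pd_eq_zero ho (hsm 1) hX2 hy 1, pd_pd_eq_zero ho (hsm 1) hX5 hy 1⟩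
  obtain ⟨H, hHs, hH⟩ := exists_eq_of_pd_eq_zero hΩ (hsm 4) fun y hy =>
    ⟨hHc 0 (by decide) (by decide) y hy, hHc 1 (by decide) (by decide) y hy,
      hHc 2 (by decide) (by decide) y hy, hHc 5 (by decide) (by decide) y hy⟩
  obtain ⟨δ₁, hδ₁s, hδ₁⟩ := exists_eq_of_pd_eq_zero hΩ (hsm1 1 1) hX1c
  obtain ⟨δ₀, hδ₀s, hδ₀⟩ := exists_eq_of_pd_eq_zero hΩ
    (F := fun y => Φ y 1 - pd 1 (fun y => Φ y 1) y * y 1)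
    ((hsm 1).sub ((hsm1 1 1).mul (by fun_prop))) (by
      intro y hy
      obtain ⟨e0, e1, e2, e5⟩ := hX1c y hy
      have hm := (hd1 1 1 y hy).fun_mul (hdc 1 y)
      refine ⟨?_, ?_, ?_, ?_⟩ <;>
        rw [pd_sub (hd 1 y hy) hm, pd_mul (hd1 1 1 y hy) (hdc 1 y), pd_coord]
      · rw [e0, hX0 y hy]; simp
      · rw [e1]; simp
      · rw [e2, hX2 y hy]; simp
      · rw [e5, hX5 y hy]; simp)
  have hexps : ContDiffOn ℝ ∞ (fun y => Φ y 4 * Φ y 0 - y 4 * y 0) Ω :=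
    ((hsm 4).mul (hsm 0)).sub (by fun_prop)
  -- The equation `U_t = (h - H T_t) U` says that `U_u exp (H T - h t)` is constant in time.
  obtain ⟨μ, hμs, hμ⟩ := exists_eq_of_pd_eq_zero hΩ
    (F := fun y => pd 2 (fun y => Φ y 2) y * Real.exp (Φ y 4 * Φ y 0 - y 4 * y 0))
    ((hsm1 2 2).mul hexps.exp) (by
      intro y hy
      have hU02 : pd 0 (pd 2 fun y => Φ y 2) y
          = (y 4 - Φ y 4 * pd 0 (fun y => Φ y 0) y) * pd 2 (fun y => Φ y 2) y := by
        have h1 := (hred y hy).2.2.2.1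
        rw [pd_congr ho (F' := fun y => y 2 * pd 2 (fun y => Φ y 2) y)
          (fun y hy => dependent_eq hΩ hΦ hy) hy, pd_mul (hdc 2 y) (hd1 2 2 y hy), pd_coord,
          dependent_eq hΩ hΦ hy] at h1
        apply mul_left_cancel₀ (hΩ.u_pos y hy).ne'
        simp at h1
        linear_combination h1
      have he := differentiableAt_of_mem ho hexps hy
      have key : ∀ i : Fin 6, pd i (fun y => pd 2 (fun y => Φ y 2) y
          * Real.exp (Φ y 4 * Φ y 0 - y 4 * y 0)) y = Real.exp (Φ y 4 * Φ y 0 - y 4 * y 0) *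
          (pd 2 (fun y => Φ y 2) y * (Φ y 4 * pd i (fun y => Φ y 0) y
            + Φ y 0 * pd i (fun y => Φ y 4) y - (y 4 * (Pi.single i 1 : JointSpace) 0
            + y 0 * (Pi.single i 1 : JointSpace) 4)) + pd i (pd 2 fun y => Φ y 2) y) := by
        intro i
        rw [pd_mul (hd1 2 2 y hy) he.exp, pd_exp he, pd_sub ((hd 4 y hy).fun_mul (hd 0 y hy))
          ((hdc 4 y).fun_mul (hdc 0 y)), pd_mul (hd 4 y hy) (hd 0 y hy), pd_mul (hdc 4 y) (hdc 0 y),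
          pd_coord, pd_coord]
        ring
      refine ⟨?_, ?_, ?_, ?_⟩ <;> rw [key]
      · rw [hHc 0 (by decide) (by decide) y hy, hU02]; simp; ring_nf
      · rw [hHc 1 (by decide) (by decide) y hy, hT1 y hy, (exponent_relation hΩ hΦ hy).1]; simp
      · rw [hHc 2 (by decide) (by decide) y hy, hT2 y hy, (hdet y hy).1]; simp
      · rw [hHc 5 (by decide) (by decide) y hy, hT5 y hy, pd_pd_eq_zero ho (hsm 2) hU5 hy 2]; simp)
  have hμpos : ∀ y ∈ Ω, 0 < μ (y 3, y 4) := fun y hy => by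
    rw [hμ y hy]
    exact mul_pos (hred y hy).2.2.2.2 (Real.exp_pos _)
  -- Chosen so that `δ₁ / α = μ ^ n`; then `U_u^n T_t = X_x` becomes `T_t = α exp (n H T - n h t)`.
  set α : ℝ × ℝ → ℝ := fun p => δ₁ p * μ p ^ (-p.1) with hα
  have hαs : ContDiffOn ℝ ∞ α (constants Ω) := by
    refine hδ₁s.mul (hμs.rpow (by fun_prop) ?_)
    rintro _ ⟨y, hy, rfl⟩
    exact (hμpos y hy).ne'
  have hconst : ContDiffOn ℝ ∞ (fun y : JointSpace => (y 3, y 4)) Ω := by fun_prop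
  have hmaps : Set.MapsTo (fun y : JointSpace => (y 3, y 4)) Ω (constants Ω) :=
    Set.mapsTo_image _ _
  have hαΩ : ContDiffOn ℝ ∞ (fun y : JointSpace => α (y 3, y 4)) Ω := hαs.comp hconst hmaps
  have hT0 : ∀ y ∈ Ω, pd 0 (fun y => Φ y 0) y
      = α (y 3, y 4) * Real.exp (y 3 * Φ y 4 * Φ y 0 - y 3 * y 4 * y 0) := by
    intro y hy
    have h1 := (hred y hy).2.1
    have hp := (hred y hy).2.2.2.2
    rw [hα]
    simp only
    rw [hμ y hy, hδ₁ y hy, ← h1, Real.mul_rpow hp.le (Real.exp_pos _).le, ← Real.exp_mul,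
      Real.rpow_neg hp.le]
    have e1 : Real.exp ((Φ y 4 * Φ y 0 - y 4 * y 0) * -y 3)
        * Real.exp (y 3 * Φ y 4 * Φ y 0 - y 3 * y 4 * y 0) = 1 := by
      rw [← Real.exp_add, ← Real.exp_zero]
      congr 1
      ring
    have e2 : pd 2 (fun y => Φ y 2) y ^ y 3 ≠ 0 := (Real.rpow_pos_of_pos hp _).ne'
    generalize Real.exp ((Φ y 4 * Φ y 0 - y 4 * y 0) * -y 3) = p at e1 ⊢
    generalize Real.exp (y 3 * Φ y 4 * Φ y 0 - y 3 * y 4 * y 0) = q at e1 ⊢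
    field_simp
    linear_combination -pd 0 (fun y => Φ y 0) y * e1
  have hA : ContDiffOn ℝ ∞ (fun y => -y 3 * Φ y 4) Ω := ContDiffOn.mul (by fun_prop) (hsm 4)
  have hA' : ContDiffOn ℝ ∞ (fun y : JointSpace => -y 3 * y 4) Ω := by fun_prop
  have hc0 : ContDiffOn ℝ ∞ (fun y : JointSpace => y 0) Ω := by fun_prop
  have hE : ContDiffOn ℝ ∞ (fun y => expInt (-y 3 * Φ y 4) (Φ y 0)) Ω :=
    contDiff_expInt.comp_contDiffOn (hA.prodMk (hsm 0))
  have hE' : ContDiffOn ℝ ∞ (fun y : JointSpace => expInt (-y 3 * y 4) (y 0)) Ω :=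
    contDiff_expInt.comp_contDiffOn (hA'.prodMk hc0)
  -- The constant of integration of the separated equation `exp (-n H T) T_t = α exp (-n h t)`.
  obtain ⟨β, hβs, hβ⟩ := exists_eq_of_pd_eq_zero hΩ
    (F := fun y => expInt (-y 3 * Φ y 4) (Φ y 0)
      - α (y 3, y 4) * expInt (-y 3 * y 4) (y 0))
    (hE.sub (hαΩ.mul hE')) (by
      intro y hy
      have key : ∀ i : Fin 6, i ≠ 3 → i ≠ 4 → pd i (fun y => expInt (-y 3 * Φ y 4) (Φ y 0)
          - α (y 3, y 4) * expInt (-y 3 * y 4) (y 0)) y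
          = Real.exp (-y 3 * Φ y 4 * Φ y 0) * pd i (fun y => Φ y 0) y
            - α (y 3, y 4) * (Real.exp (-y 3 * y 4 * y 0) * (Pi.single i 1 : JointSpace) 0) := by
        intro i h3 h4
        have hAi : ∀ w ∈ Ω, pd i (fun y => -y 3 * Φ y 4) w = 0 := fun w hw =>
          pd_comp_constants ho (f := fun p => -p.1 * H p) hA
            (fun y hy => by simp only; rw [hH y hy]) hw h3 h4
        have hAi' : ∀ w ∈ Ω, pd i (fun y => -y 3 * y 4) w = 0 := fun w hw =>
          pd_comp_constants ho (f := fun p => -p.1 * p.2) hA' (fun y hy => rfl) hw h3 h4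
        have hαd := differentiableAt_of_mem ho hαΩ hy
        have hEd := differentiableAt_of_mem ho hE' hy
        rw [pd_sub (differentiableAt_of_mem ho hE hy) (hαd.fun_mul hEd), pd_mul hαd hEd,
          pd_comp_constants ho hαΩ (fun _ _ => rfl) hy h3 h4, pd_expInt ho hA (hsm 0) hAi hy,
          pd_expInt ho hA' hc0 hAi' hy, pd_coord]
        ring
      refine ⟨?_, ?_, ?_, ?_⟩ <;> rw [key _ (by decide) (by decide)]
      · rw [hT0 y hy, mul_left_comm, ← Real.exp_add]
        simp
        ring_nf
      · rw [hT1 y hy]; simp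
      · rw [hT2 y hy]; simp
      · rw [hT5 y hy]; simp)
  refine ⟨H, α, β, δ₀, δ₁, hHs, hαs, hβs, hδ₀s, hδ₁s, ?_, ?_⟩
  · rintro n h ⟨y, hy, hnh⟩
    simp only [Prod.mk.injEq] at hnh
    obtain ⟨rfl, rfl⟩ := hnh
    refine ⟨deriv_damping_ne_zero hΩ hΦ hH hy, ?_⟩
    have h1 : δ₁ (y 3, y 4) ≠ 0 := by rw [hδ₁ y hy]; exact (pd_space hΩ hΦ hy).2.1
    have h2 : 0 < μ (y 3, y 4) ^ (-y 3) := Real.rpow_pos_of_pos (hμpos y hy) _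
    have h3 : 0 < δ₁ (y 3, y 4) * δ₁ (y 3, y 4) := mul_self_pos.2 h1
    have : α (y 3, y 4) * δ₁ (y 3, y 4)
        = δ₁ (y 3, y 4) * δ₁ (y 3, y 4) * μ (y 3, y 4) ^ (-y 3) := by
      simp only [hα]; ring
    rw [this]
    positivity
  · intro t x u n h g hy
    set y : JointSpace := ![t, x, u, n, h, g] with hydef
    have hn : n ≠ 0 := hΩ.n_ne_zero y hy
    have eH : H (n, h) = Φ y 4 := hH y hy
    have eδ₁ : δ₁ (n, h) = pd 1 (fun y => Φ y 1) y := hδ₁ y hy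
    have eδ₀ : δ₀ (n, h) = Φ y 1 - pd 1 (fun y => Φ y 1) y * x := hδ₀ y hy
    have eμ : μ (n, h) = pd 2 (fun y => Φ y 2) y * Real.exp (Φ y 4 * Φ y 0 - h * t) := hμ y hy
    have eβ : β (n, h) = expInt (-n * Φ y 4) (Φ y 0) - α (n, h) * expInt (-n * h) t := hβ y hy
    have eT0 : pd 0 (fun y => Φ y 0) y
      = α (n, h) * Real.exp (n * Φ y 4 * Φ y 0 - n * h * t) := hT0 y hy
    have hμp : 0 < μ (n, h) := hμpos y hy
    have hδ₁0 : δ₁ (n, h) ≠ 0 := by rw [eδ₁]; exact (pd_space hΩ hΦ hy).2.1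
    have eα : α (n, h) = δ₁ (n, h) * μ (n, h) ^ (-n) := rfl
    have hα0 : α (n, h) ≠ 0 := by
      rw [eα]; exact mul_ne_zero hδ₁0 (Real.rpow_pos_of_pos hμp _).ne'
    have hroot : (δ₁ (n, h) / α (n, h)) ^ (1 / n) = μ (n, h) := by
      have : δ₁ (n, h) / α (n, h) = μ (n, h) ^ n := by
        rw [eα, Real.rpow_neg hμp.le]
        have := (Real.rpow_pos_of_pos hμp n).ne'
        field_simp
      rw [this, ← Real.rpow_mul hμp.le, mul_one_div_cancel hn, Real.rpow_one]
    refine ⟨Φ y 0, (timeRelation_iff hn).2 ?_, ?_⟩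
    · rw [eH, eβ]; ring
    · have e1 : Φ y 1 = δ₁ (n, h) * x + δ₀ (n, h) := by rw [eδ₁, eδ₀]; ring
      have e2 : Φ y 2 = (δ₁ (n, h) / α (n, h)) ^ (1 / n)
          * Real.exp (h * t - H (n, h) * Φ y 0) * u := by
        have h1 : Φ y 2 = u * pd 2 (fun y => Φ y 2) y := dependent_eq hΩ hΦ hy
        rw [hroot, eμ, h1, eH, mul_assoc _ (Real.exp _) (Real.exp _), ← Real.exp_add]
        ring_nf
        simp
      have e3 : Φ y 3 = n := (exponent_eq hΩ hΦ hy).1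
      have e5 : Φ y 5 = δ₁ (n, h) ^ 2 / α (n, h)
          * Real.exp (n * h * t - n * H (n, h) * Φ y 0) * g := by
        have h1 : g * pd 1 (fun y => Φ y 1) y ^ 2 = Φ y 5 * pd 0 (fun y => Φ y 0) y :=
          (pd_space hΩ hΦ hy).2.2.2
        have h2 : Real.exp (n * h * t - n * Φ y 4 * Φ y 0)
            * Real.exp (n * Φ y 4 * Φ y 0 - n * h * t) = 1 := by
          rw [← Real.exp_add, ← Real.exp_zero]
          congr 1
          ring
        rw [eT0, ← eδ₁] at h1
        rw [eH]
        generalize Real.exp (n * h * t - n * Φ y 4 * Φ y 0) = p at h2 ⊢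
        generalize Real.exp (n * Φ y 4 * Φ y 0 - n * h * t) = q at h1 h2
        field_simp
        linear_combination -Φ y 5 * α (n, h) * h2 - p * h1
      rw [← e1, ← e2, ← e5, eH]
      conv_rhs => rw [← e3]
      exact (eq_vec (Φ y)).symm

end Slices

end GenBurgers

/-! ### Sufficiency: smoothness and nondegeneracy of the standard form -/

namespace GenBurgers

/-- Solutions `B` of `expInt A B = S` depend smoothly on parameters. -/
theorem contDiffAt_of_expInt_eq {E : Type*} [NormedAddCommGroup E] [NormedSpace ℝ E]
    {A B S : E → ℝ} {p : E} (hA : ContDiffAt ℝ ∞ A p) (hS : ContDiffAt ℝ ∞ S p)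
    (h : ∀ᶠ q in 𝓝 p, expInt (A q) (B q) = S q) : ContDiffAt ℝ ∞ B p := by
  -- The inverse function theorem applies to `Ψ`. Global injectivity identifies `B` with the local
  -- inverse, so no continuity of `B` has to be assumed.
  set Ψ : ℝ × ℝ → ℝ × ℝ := fun q => (q.1, expInt q.1 q.2) with hΨ
  have hΨs : ContDiff ℝ ∞ Ψ := contDiff_fst.prodMk contDiff_expInt
  have hΨinj : Function.Injective Ψ := by
    rintro ⟨a, t⟩ ⟨b, s⟩ hab
    simp only [hΨ, Prod.mk.injEq] at hab
    obtain ⟨rfl, h2⟩ := hab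
    rw [(strictMono_expInt a).injective h2]
  set q₀ : ℝ × ℝ := (A p, B p) with hq₀
  have hd := (hΨs.differentiable (by simp) q₀).hasFDerivAt
  have hE := (contDiff_expInt.differentiable (by simp) q₀).hasFDerivAt
  have hΨd : fderiv ℝ Ψ q₀ = _ := (hasFDerivAt_fst.prodMk hE).fderiv
  have hE2 : fderiv ℝ (fun p : ℝ × ℝ => expInt p.1 p.2) q₀ (0, 1) = Real.exp (A p * B p) := by
    have h1 := hE.comp_hasDerivAt (B p) ((hasDerivAt_const (B p) (A p)).prodMk (hasDerivAt_id (B p)))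
    exact h1.unique (hasDerivAt_expInt (A p) (B p))
  have hinj : Function.Injective (fderiv ℝ Ψ q₀ : ℝ × ℝ →ₗ[ℝ] ℝ × ℝ) := by
    rw [← LinearMap.ker_eq_bot, LinearMap.ker_eq_bot']
    rintro ⟨a, b⟩ hab
    have hab' : fderiv ℝ Ψ q₀ (a, b) = 0 := hab
    rw [hΨd, ContinuousLinearMap.prod_apply, Prod.mk_eq_zero] at hab'
    obtain ⟨h1, h2⟩ := hab'
    have ha : a = 0 := h1
    subst ha
    have hb : ((0, b) : ℝ × ℝ) = b • (0, 1) := by simp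
    rw [hb, map_smul, hE2, smul_eq_mul, mul_eq_zero] at h2
    simp [h2.resolve_right (Real.exp_pos _).ne']
  let e := (LinearEquiv.ofInjectiveEndo _ hinj).toContinuousLinearEquiv
  have he : HasFDerivAt Ψ (e : ℝ × ℝ →L[ℝ] ℝ × ℝ) q₀ := by
    have : (e : ℝ × ℝ →L[ℝ] ℝ × ℝ) = fderiv ℝ Ψ q₀ := by
      ext <;> rfl
    rw [this]
    exact hd
  have hΨat := hΨs.contDiffAt (x := q₀)
  have hinvs := hΨat.to_localInverse he (by simp)
  have hright : ∀ᶠ q in 𝓝 (Ψ q₀), Ψ (hΨat.localInverse he (by simp) q) = q :=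
    (hΨat.hasStrictFDerivAt' he (by simp)).eventually_right_inverse
  have hp : (A p, S p) = Ψ q₀ := by
    simp only [hΨ, hq₀, h.self_of_nhds]
  have hAS : ContDiffAt ℝ ∞ (fun q => (A q, S q)) p := hA.prodMk hS
  have hcomp : ContDiffAt ℝ ∞ (fun q => (hΨat.localInverse he (by simp) (A q, S q)).2) p := by
    refine contDiff_snd.contDiffAt.comp p (ContDiffAt.comp (g := hΨat.localInverse he (by simp)) p
      ?_ hAS)
    rw [hp]
    exact hinvs
  refine hcomp.congr_of_eventuallyEq ?_
  have hev := hAS.continuousAt.eventually (p := fun q => Ψ (hΨat.localInverse he (by simp) q) = q)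
    (by simp only [hp]; exact hright)
  filter_upwards [h, hev] with q h1 h2
  have : hΨat.localInverse he (by simp) (A q, S q) = (A q, B q) := by
    apply hΨinj
    rw [h2]
    simp only [hΨ, h1]
  rw [this]

/-- The data of a transformation of the form given in the classification, with the time
component described through `expInt`. -/
structure IsStandardForm (Ω : Set JointSpace) (Φ : JointSpace → JointSpace)
    (H α β δ₀ δ₁ : ℝ × ℝ → ℝ) : Prop where
  smooth_H : ContDiffOn ℝ ∞ H (constants Ω)
  smooth_α : ContDiffOn ℝ ∞ α (constants Ω)
  smooth_β : ContDiffOn ℝ ∞ β (constants Ω)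
  smooth_δ₀ : ContDiffOn ℝ ∞ δ₀ (constants Ω)
  smooth_δ₁ : ContDiffOn ℝ ∞ δ₁ (constants Ω)
  deriv_ne_zero : ∀ z ∈ Ω, deriv (fun k => H (z 3, k)) (z 4) ≠ 0
  pos : ∀ z ∈ Ω, 0 < α (z 3, z 4) * δ₁ (z 3, z 4)
  time : ∀ z ∈ Ω, expInt (-z 3 * H (z 3, z 4)) (Φ z 0)
    = α (z 3, z 4) * expInt (-z 3 * z 4) (z 0) + β (z 3, z 4)
  space : ∀ z ∈ Ω, Φ z 1 = δ₁ (z 3, z 4) * z 1 + δ₀ (z 3, z 4)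
  dependent : ∀ z ∈ Ω, Φ z 2 = (δ₁ (z 3, z 4) / α (z 3, z 4)) ^ (1 / z 3)
    * Real.exp (z 4 * z 0 - H (z 3, z 4) * Φ z 0) * z 2
  exponent : ∀ z ∈ Ω, Φ z 3 = z 3
  damping : ∀ z ∈ Ω, Φ z 4 = H (z 3, z 4)
  coeff : ∀ z ∈ Ω, Φ z 5 = δ₁ (z 3, z 4) ^ 2 / α (z 3, z 4)
    * Real.exp (z 3 * z 4 * z 0 - z 3 * H (z 3, z 4) * Φ z 0) * z 5

namespace IsStandardForm

variable {Ω : Set JointSpace} {Φ : JointSpace → JointSpace} {H α β δ₀ δ₁ : ℝ × ℝ → ℝ}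
  {z : JointSpace}

theorem α_ne_zero (hs : IsStandardForm Ω Φ H α β δ₀ δ₁) (hz : z ∈ Ω) : α (z 3, z 4) ≠ 0 :=
  left_ne_zero_of_mul (hs.pos z hz).ne'

theorem δ₁_ne_zero (hs : IsStandardForm Ω Φ H α β δ₀ δ₁) (hz : z ∈ Ω) : δ₁ (z 3, z 4) ≠ 0 :=
  right_ne_zero_of_mul (hs.pos z hz).ne'

theorem div_pos (hs : IsStandardForm Ω Φ H α β δ₀ δ₁) (hz : z ∈ Ω) :
    0 < δ₁ (z 3, z 4) / α (z 3, z 4) := by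
  have h := hs.pos z hz
  have h1 := hs.α_ne_zero hz
  have : δ₁ (z 3, z 4) / α (z 3, z 4)
      = (α (z 3, z 4) * δ₁ (z 3, z 4)) / (α (z 3, z 4) * α (z 3, z 4)) := by field_simp
  rw [this]
  exact _root_.div_pos h (mul_self_pos.2 h1)

theorem contDiffOn_comp_constants {f : ℝ × ℝ → ℝ} (hf : ContDiffOn ℝ ∞ f (constants Ω)) :
    ContDiffOn ℝ ∞ (fun z : JointSpace => f (z 3, z 4)) Ω :=
  hf.comp (f := fun z : JointSpace => (z 3, z 4)) (by fun_prop) (Set.mapsTo_image _ _)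

theorem contDiffOn_expInt_time :
    ContDiffOn ℝ ∞ (fun z : JointSpace => expInt (-z 3 * z 4) (z 0)) Ω :=
  contDiff_expInt.comp_contDiffOn
    (ContDiffOn.prodMk (f := fun z : JointSpace => -z 3 * z 4) (by fun_prop) (by fun_prop))

theorem contDiffOn_time (hΩ : IsOpen Ω) (hs : IsStandardForm Ω Φ H α β δ₀ δ₁) :
    ContDiffOn ℝ ∞ (fun z => Φ z 0) Ω := by
  intro z hz
  refine ContDiffAt.contDiffWithinAt ?_
  have hA : ContDiffOn ℝ ∞ (fun z : JointSpace => -z 3 * H (z 3, z 4)) Ω :=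
    ContDiffOn.mul (by fun_prop) (contDiffOn_comp_constants hs.smooth_H)
  have hS : ContDiffOn ℝ ∞ (fun z : JointSpace => α (z 3, z 4) * expInt (-z 3 * z 4) (z 0)
      + β (z 3, z 4)) Ω :=
    ((contDiffOn_comp_constants hs.smooth_α).mul contDiffOn_expInt_time).add
      (contDiffOn_comp_constants hs.smooth_β)
  refine contDiffAt_of_expInt_eq (contDiffAt_of_mem hΩ hA hz) (contDiffAt_of_mem hΩ hS hz) ?_
  filter_upwards [hΩ.mem_nhds hz] with y hy using hs.time y hy

theorem contDiffOn_component (hΩ : IsTransformationDomain Ω)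
    (hs : IsStandardForm Ω Φ H α β δ₀ δ₁) (i : Fin 6) : ContDiffOn ℝ ∞ (fun z => Φ z i) Ω := by
  have hT := hs.contDiffOn_time hΩ.isOpen
  have hH := contDiffOn_comp_constants hs.smooth_H
  have hα := contDiffOn_comp_constants hs.smooth_α
  have hδ₀ := contDiffOn_comp_constants hs.smooth_δ₀
  have hδ₁ := contDiffOn_comp_constants hs.smooth_δ₁
  have hc : ∀ i : Fin 6, ContDiffOn ℝ ∞ (fun z : JointSpace => z i) Ω := fun i => by fun_prop
  fin_cases i
  · exact hT
  · exact ((hδ₁.mul (hc 1)).add hδ₀).congr hs.space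
  · refine ContDiffOn.congr ?_ hs.dependent
    refine (ContDiffOn.mul ?_ (ContDiffOn.exp (((hc 4).mul (hc 0)).sub (hH.mul hT)))).mul (hc 2)
    refine ContDiffOn.rpow (hδ₁.div hα fun z hz => hs.α_ne_zero hz)
      (contDiffOn_const.div (hc 3) hΩ.n_ne_zero) fun z hz => (hs.div_pos hz).ne'
  · exact (hc 3).congr hs.exponent
  · exact hH.congr hs.damping
  · refine ContDiffOn.congr ?_ hs.coeff
    exact (((hδ₁.pow 2).div hα fun z hz => hs.α_ne_zero hz).mul
      (ContDiffOn.exp ((((hc 3).mul (hc 4)).mul (hc 0)).sub (((hc 3).mul hH).mul hT)))).mul (hc 5)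

/-- Strict monotonicity of `expInt` makes the new time a function of `(t, n, h)` alone, globally on
`Ω`. -/
theorem time_eq (hs : IsStandardForm Ω Φ H α β δ₀ δ₁) {y : JointSpace} (hz : z ∈ Ω) (hy : y ∈ Ω)
    (h0 : y 0 = z 0) (h3 : y 3 = z 3) (h4 : y 4 = z 4) : Φ y 0 = Φ z 0 := by
  have h1 := hs.time y hy
  rw [h0, h3, h4, ← hs.time z hz] at h1
  exact (strictMono_expInt _).injective h1

theorem pd_eq_zero_of_eventually {F : JointSpace → ℝ} {i : Fin 6} (hF : DifferentiableAt ℝ F z)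
    (h : ∀ᶠ s : ℝ in 𝓝 0, F (z + s • Pi.single i 1) = F z) : pd i F z = 0 := by
  have h1 := hasDerivAt_line hF (Pi.single i 1) (s := 0) (y := z) (by simp)
  exact h1.unique ((hasDerivAt_const (0 : ℝ) (F z)).congr_of_eventuallyEq h)

/-- In the order `n`, `h`, `t`, `x`, `u`, `g` the Jacobian matrix is triangular with nonzero
diagonal, so a kernel vector vanishes component by component. -/
theorem det_ne_zero (hΩ : IsTransformationDomain Ω) (hs : IsStandardForm Ω Φ H α β δ₀ δ₁)
    (hz : z ∈ Ω) : (fderiv ℝ Φ z).det ≠ 0 := by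
  have ho := hΩ.isOpen
  have hsm := hs.contDiffOn_component hΩ
  have hd := fun i => differentiableAt_of_mem ho (hsm i) hz
  have hH := contDiffOn_comp_constants hs.smooth_H
  have hα := contDiffOn_comp_constants hs.smooth_α
  have hβ := contDiffOn_comp_constants hs.smooth_β
  have hline : ∀ i : Fin 6, ∀ᶠ s : ℝ in 𝓝 0, z + s • (Pi.single i 1 : JointSpace) ∈ Ω := fun i =>
    eventually_mem_line ho hz _
  have hTi : ∀ i : Fin 6, i ≠ 0 → i ≠ 3 → i ≠ 4 →
      ∀ᶠ s : ℝ in 𝓝 0, Φ (z + s • Pi.single i 1) 0 = Φ z 0 := by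
    intro i h0 h3 h4
    filter_upwards [hline i] with s hs'
    exact hs.time_eq hz hs' (by simp [h0.symm]) (by simp [h3.symm]) (by simp [h4.symm])
  have hT0 : pd 0 (fun y => Φ y 0) z ≠ 0 := by
    intro h0
    have hA : ContDiffOn ℝ ∞ (fun z : JointSpace => -z 3 * H (z 3, z 4)) Ω :=
      ContDiffOn.mul (by fun_prop) hH
    have hA' : ContDiffOn ℝ ∞ (fun z : JointSpace => -z 3 * z 4) Ω := by fun_prop
    have h1 := pd_expInt ho hA (hsm 0) (i := 0) (fun y hy => pd_comp_constants ho
      (f := fun p => -p.1 * H p) hA (fun _ _ => rfl) hy (by decide) (by decide)) hz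
    have h2 := pd_expInt ho hA' (B := fun y => y 0) (by fun_prop) (i := 0)
      (fun y hy => pd_comp_constants ho (f := fun p => -p.1 * p.2) hA' (fun _ _ => rfl) hy
        (by decide) (by decide)) hz
    have hE : ContDiffOn ℝ ∞ (fun z : JointSpace => α (z 3, z 4) * expInt (-z 3 * z 4) (z 0)) Ω :=
      hα.mul contDiffOn_expInt_time
    have h3 := pd_congr ho (F' := fun y => α (y 3, y 4) * expInt (-y 3 * y 4) (y 0)
      - (-1) * β (y 3, y 4)) (fun y hy => (hs.time y hy).trans (by ring)) hz 0
    have hβ' : ContDiffOn ℝ ∞ (fun y : JointSpace => (-1) * β (y 3, y 4)) Ω :=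
      contDiffOn_const.mul hβ
    rw [h1, h0, pd_sub (differentiableAt_of_mem ho hE hz) (differentiableAt_of_mem ho hβ' hz),
      pd_mul (differentiableAt_of_mem ho hα hz)
        (differentiableAt_of_mem ho contDiffOn_expInt_time hz), h2,
      pd_comp_constants ho hα (fun _ _ => rfl) hz (by decide) (by decide),
      pd_comp_constants ho hβ' (f := fun p => (-1) * β p) (fun _ _ => rfl) hz (by decide)
        (by decide), pd_coord] at h3
    simp [hs.α_ne_zero hz] at h3
  have hX2 : ∀ i : Fin 6, i ≠ 1 → i ≠ 3 → i ≠ 4 → pd i (fun y => Φ y 1) z = 0 := by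
    intro i h1 h3 h4
    refine pd_eq_zero_of_eventually (hd 1) ?_
    filter_upwards [hline i] with s hs'
    rw [hs.space _ hs', hs.space z hz]
    simp [h1.symm, h3.symm, h4.symm]
  have hX1 : pd 1 (fun y => Φ y 1) z = δ₁ (z 3, z 4) := by
    have h1 := hasDerivAt_line (hd 1) (Pi.single 1 1) (s := 0) (y := z) (by simp)
    refine h1.unique ?_
    have h2 : HasDerivAt (fun s : ℝ => δ₁ (z 3, z 4) * (z 1 + s) + δ₀ (z 3, z 4))
        (δ₁ (z 3, z 4)) 0 := by
      simpa using (((hasDerivAt_id (0 : ℝ)).const_add (z 1)).const_mul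
        (δ₁ (z 3, z 4))).add_const (δ₀ (z 3, z 4))
    refine h2.congr_of_eventuallyEq ?_
    filter_upwards [hline 1] with s hs'
    rw [hs.space _ hs']
    simp
  have hU5 : pd 5 (fun y => Φ y 2) z = 0 := by
    refine pd_eq_zero_of_eventually (hd 2) ?_
    filter_upwards [hline 5, hTi 5 (by decide) (by decide) (by decide)] with s hs' hT
    rw [hs.dependent _ hs', hs.dependent z hz, hT]
    simp
  have hU2 : pd 2 (fun y => Φ y 2) z ≠ 0 := by
    have h1 := hasDerivAt_line (hd 2) (Pi.single 2 1) (s := 0) (y := z) (by simp)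
    set k := (δ₁ (z 3, z 4) / α (z 3, z 4)) ^ (1 / z 3)
      * Real.exp (z 4 * z 0 - H (z 3, z 4) * Φ z 0) with hk
    have hk0 : k ≠ 0 :=
      (mul_pos (Real.rpow_pos_of_pos (hs.div_pos hz) _) (Real.exp_pos _)).ne'
    have h2 : HasDerivAt (fun s : ℝ => k * (z 2 + s)) k 0 := by
      simpa using ((hasDerivAt_id (0 : ℝ)).const_add (z 2)).const_mul k
    have h3 := h1.unique (h2.congr_of_eventuallyEq (by
      filter_upwards [hline 2, hTi 2 (by decide) (by decide) (by decide)] with s hs' hT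
      rw [hs.dependent _ hs', hT]
      simp [hk]))
    rw [pd, h3]
    exact hk0
  have hG5 : pd 5 (fun y => Φ y 5) z ≠ 0 := by
    have h1 := hasDerivAt_line (hd 5) (Pi.single 5 1) (s := 0) (y := z) (by simp)
    set k := δ₁ (z 3, z 4) ^ 2 / α (z 3, z 4)
      * Real.exp (z 3 * z 4 * z 0 - z 3 * H (z 3, z 4) * Φ z 0) with hk
    have hk0 : k ≠ 0 :=
      mul_ne_zero (div_ne_zero (pow_ne_zero 2 (hs.δ₁_ne_zero hz)) (hs.α_ne_zero hz))
        (Real.exp_pos _).ne'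
    have h2 : HasDerivAt (fun s : ℝ => k * (z 5 + s)) k 0 := by
      simpa using ((hasDerivAt_id (0 : ℝ)).const_add (z 5)).const_mul k
    have h3 := h1.unique (h2.congr_of_eventuallyEq (by
      filter_upwards [hline 5, hTi 5 (by decide) (by decide) (by decide)] with s hs' hT
      rw [hs.coeff _ hs', hT]
      simp [hk]))
    rw [pd, h3]
    exact hk0
  have hH4 : pd 4 (fun y => Φ y 4) z ≠ 0 := by
    have h1 : HasDerivAt (fun s => Φ (z + s • Pi.single 4 1) 4) (pd 4 (fun y => Φ y 4) z)
        (z 4 - z 4) := hasDerivAt_line (hd 4) (Pi.single 4 1) (y := z) (by simp)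
    have h2 := h1.comp_sub_const (z 4) (z 4)
    have h3 := (h2.congr_of_eventuallyEq (f₁ := fun k => H (z 3, k)) (by
      have hc : ContinuousAt (fun k => k - z 4) (z 4) := by fun_prop
      have hev := hc.eventually (p := fun s => z + s • (Pi.single 4 1 : JointSpace) ∈ Ω)
        (by simp only [sub_self]; exact hline 4)
      filter_upwards [hev] with k hk
      rw [hs.damping _ hk]
      simp)).deriv
    rw [← h3]
    exact hs.deriv_ne_zero z hz
  have hdΦ : DifferentiableAt ℝ Φ z := differentiableAt_pi.2 hd
  have hinj : LinearMap.ker (fderiv ℝ Φ z : JointSpace →ₗ[ℝ] JointSpace) = ⊥ := by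
    rw [LinearMap.ker_eq_bot']
    intro V hV
    have hV' : fderiv ℝ Φ z V = 0 := hV
    have hcomp : ∀ i, ∑ j, V j * pd j (fun y => Φ y i) z = 0 := by
      intro i
      have hi : HasFDerivAt (fun y => Φ y i) _ z := hasFDerivAt_pi'.1 hdΦ.hasFDerivAt i
      rw [← fderiv_eq_sum_pd, hi.fderiv, ContinuousLinearMap.comp_apply, hV', map_zero]
    simp only [Fin.sum_univ_six] at hcomp
    have hV3 : V 3 = 0 := by
      have h1 := hcomp 3
      simp only [pd_congr ho hs.exponent hz, pd_coord] at h1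
      simpa using h1
    have hV4 : V 4 = 0 := by
      have h1 := hcomp 4
      have hp := fun (i : Fin 6) h3 h4 => pd_comp_constants (i := i) ho (hsm 4) hs.damping hz h3 h4
      rw [hp 0 (by decide) (by decide), hp 1 (by decide) (by decide), hp 2 (by decide) (by decide),
        hp 5 (by decide) (by decide), hV3] at h1
      simpa [hH4] using h1
    have hV0 : V 0 = 0 := by
      have h1 := hcomp 0
      have hp := fun (i : Fin 6) h0 h3 h4 => pd_eq_zero_of_eventually (hd 0) (hTi i h0 h3 h4)
      rw [hp 1 (by decide) (by decide) (by decide), hp 2 (by decide) (by decide) (by decide),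
        hp 5 (by decide) (by decide) (by decide), hV3, hV4] at h1
      simpa [hT0] using h1
    have hV1 : V 1 = 0 := by
      have h1 := hcomp 1
      rw [hX1, hX2 2 (by decide) (by decide) (by decide), hX2 5 (by decide) (by decide) (by decide),
        hV0, hV3, hV4] at h1
      simpa [hs.δ₁_ne_zero hz] using h1
    have hV2 : V 2 = 0 := by
      have h1 := hcomp 2
      rw [hV0, hV1, hV3, hV4, hU5] at h1
      simpa [hU2] using h1
    have hV5 : V 5 = 0 := by
      have h1 := hcomp 5
      rw [hV0, hV1, hV2, hV3, hV4] at h1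
      simpa [hG5] using h1
    rw [← eq_vec V, hV0, hV1, hV2, hV3, hV4, hV5]
    simp
  intro h0
  have hlt := LinearMap.bot_lt_ker_of_det_eq_zero
    (f := (fderiv ℝ Φ z : JointSpace →ₗ[ℝ] JointSpace)) h0
  rw [hinj] at hlt
  exact lt_irrefl _ hlt

end IsStandardForm

end GenBurgers

/-! ### Sufficiency: the equation is mapped within the class -/

namespace GenBurgers

theorem iteratedDeriv_two_comp_affine (f : ℝ → ℝ) (k l x : ℝ) :
    deriv (fun y => f (k * y + l)) x = k * deriv f (k * x + l) ∧
      iteratedDeriv 2 (fun y => f (k * y + l)) x = k ^ 2 * iteratedDeriv 2 f (k * x + l) := by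
  have h1 : ∀ (f : ℝ → ℝ) (x : ℝ), deriv (fun y => f (k * y + l)) x = k * deriv f (k * x + l) := by
    intro f x
    have h := deriv_comp_mul_left k (fun y => f (y + l)) x
    rw [deriv_comp_add_const] at h
    exact h
  refine ⟨h1 f x, ?_⟩
  simp only [iteratedDeriv_succ, iteratedDeriv_zero]
  have h2 : (deriv fun y => f (k * y + l)) = fun y => k * deriv f (k * y + l) := funext (h1 f)
  rw [h2, deriv_const_mul_field, h1]
  ring

/-- The transformations of standard form map solutions to solutions. -/
theorem satisfiesAt_iff_of_standard {n h H α δ₀ δ₁ μ t x : ℝ} {g G T : ℝ → ℝ} {v w : ℝ → ℝ → ℝ}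
    (hα : α ≠ 0) (hδ₁ : δ₁ ≠ 0) (hμ : 0 < μ) (hμn : μ ^ n = δ₁ / α)
    (hT : HasDerivAt T (α * Real.exp (n * H * T t - n * h * t)) t)
    (hG : G (T t) = δ₁ ^ 2 / α * Real.exp (n * h * t - n * H * T t) * g t)
    (hv0 : 0 < v t x) (hv : ContDiffAt ℝ ∞ (Function.uncurry v) (t, x))
    (hw : ContDiffAt ℝ ∞ (Function.uncurry w) (T t, δ₁ * x + δ₀))
    (hrel : ∀ᶠ p : ℝ × ℝ in 𝓝 (t, x), w (T p.1) (δ₁ * p.2 + δ₀)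
      = μ * Real.exp (h * p.1 - H * T p.1) * v p.1 p.2) :
    SatisfiesAt n h g v t x ↔ SatisfiesAt n H G w (T t) (δ₁ * x + δ₀) := by
  set c := μ * Real.exp (h * t - H * T t) with hc
  have hc0 : 0 < c := mul_pos hμ (Real.exp_pos _)
  have hval : w (T t) (δ₁ * x + δ₀) = c * v t x := hrel.self_of_nhds
  have hx : (fun y => w (T t) (δ₁ * y + δ₀)) =ᶠ[𝓝 x] fun y => c * v t y := by
    have : ContinuousAt (fun y : ℝ => (t, y)) x := by fun_prop
    exact this.eventually hrel
  obtain ⟨hd1, hd2⟩ := iteratedDeriv_two_comp_affine (fun y => w (T t) y) δ₁ δ₀ x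
  rw [hx.deriv_eq, deriv_const_mul_field] at hd1
  rw [hx.iteratedDeriv_eq, iteratedDeriv_const_mul_field] at hd2
  have ht : (fun s => w (T s) (δ₁ * x + δ₀)) =ᶠ[𝓝 t]
      fun s => μ * Real.exp (h * s - H * T s) * v s x := by
    have : ContinuousAt (fun s : ℝ => (s, x)) t := by fun_prop
    exact this.eventually hrel
  have hvt : HasDerivAt (fun s => v s x) (deriv (fun s => v s x) t) t := by
    have h1 := (hv.differentiableAt (by simp)).hasFDerivAt.comp_hasDerivAt t
      ((hasDerivAt_id t).prodMk (hasDerivAt_const t x))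
    exact h1.differentiableAt.hasDerivAt
  have hwt : HasDerivAt (fun s => w s (δ₁ * x + δ₀)) (deriv (fun s => w s (δ₁ * x + δ₀)) (T t))
      (T t) := by
    have h1 := (hw.differentiableAt (by simp)).hasFDerivAt.comp_hasDerivAt (T t)
      ((hasDerivAt_id (T t)).prodMk (hasDerivAt_const (T t) (δ₁ * x + δ₀)))
    exact h1.differentiableAt.hasDerivAt
  set T' := α * Real.exp (n * H * T t - n * h * t) with hT'
  have he : HasDerivAt (fun s => μ * Real.exp (h * s - H * T s)) (c * (h - H * T')) t := by
    have h1 := ((((hasDerivAt_id t).const_mul h).sub (hT.const_mul H)).exp).const_mul μ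
    refine h1.congr_deriv ?_
    simp [hc]
    ring
  have hd0 := (hwt.comp t hT).unique ((he.mul hvt).congr_of_eventuallyEq ht)
  rw [← hc] at hd0
  have hcn : c ^ n = δ₁ / α * Real.exp (n * h * t - n * H * T t) := by
    rw [hc, Real.mul_rpow hμ.le (Real.exp_pos _).le, hμn, ← Real.exp_mul]
    congr 2
    ring
  have hee : Real.exp (n * H * T t - n * h * t) * Real.exp (n * h * t - n * H * T t) = 1 := by
    rw [← Real.exp_add, ← Real.exp_zero]
    congr 1
    ring
  unfold SatisfiesAt
  rw [hval, hG, Real.mul_rpow hc0.le hv0.le, hcn]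
  generalize deriv (fun s => w s (δ₁ * x + δ₀)) (T t) = wT at *
  generalize deriv (fun y => w (T t) y) (δ₁ * x + δ₀) = wX at *
  generalize iteratedDeriv 2 (fun y => w (T t) y) (δ₁ * x + δ₀) = wXX at *
  generalize deriv (fun s => v s x) t = vt at *
  generalize deriv (fun y => v t y) x = vx at *
  generalize iteratedDeriv 2 (fun y => v t y) x = vxx at *
  generalize v t x ^ n = q at *
  generalize Real.exp (n * H * T t - n * h * t) = E' at *
  generalize Real.exp (n * h * t - n * H * T t) = E at *
  have hE : E ≠ 0 := right_ne_zero_of_mul (hee.trans_ne one_ne_zero)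
  have e1 : wX = c * vx / δ₁ := by field_simp; linear_combination -hd1
  have e2 : wXX = c * vxx / δ₁ ^ 2 := by field_simp; linear_combination -hd2
  have e3 : wT = c * E / α * (vt + h * v t x) - c * H * v t x := by
    have : wT * E' * α = c * vt + c * h * v t x - c * H * (α * E') * v t x := by
      rw [hT'] at hd0; linear_combination hd0
    field_simp
    linear_combination E * this - (wT * α + c * H * α * v t x) * hee
  -- The residual of the new equation is `c E / α` times that of the old one.
  have key : wT + δ₁ / α * E * q * wX + H * (c * v t x) - δ₁ ^ 2 / α * E * g t * wXX
      = c * E / α * (vt + q * vx + h * v t x - g t * vxx) := by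
    rw [e1, e2, e3]
    field_simp
    ring
  have hk : c * E / α ≠ 0 := div_ne_zero (mul_ne_zero hc0.ne' hE) hα
  rw [← sub_eq_zero, ← sub_eq_zero (b := δ₁ ^ 2 / α * E * g t * wXX), key, mul_eq_zero]
  simp [hk]

/-- The new time interval consists of all solutions of the time relation with `t ∈ I`; there the old
time is a smooth function `τ` of the new one, and `G` is the transformed `g` written in terms of it.
-/
theorem exists_image_inClass {n h H α β κ : ℝ} {g : ℝ → ℝ} {I : Set ℝ} (hg : InClass n h g I)
    (hα : α ≠ 0) (hκ : κ ≠ 0) :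
    ∃ (G : ℝ → ℝ) (J : Set ℝ), InClass n H G J ∧ ∀ t ∈ I, ∀ T : ℝ,
      expInt (-n * H) T = α * expInt (-n * h) t + β →
        T ∈ J ∧ G T = κ * Real.exp (n * h * t - n * H * T) * g t := by
  classical
  set f : ℝ → ℝ := fun t => α * expInt (-n * h) t + β with hf
  have hfd : ∀ t, HasDerivAt f (α * Real.exp (-n * h * t)) t := fun t =>
    ((hasDerivAt_expInt _ t).const_mul α).add_const β
  have hfinj : Function.Injective f := by
    intro s t hst
    simp only [hf, add_left_inj] at hst
    exact (strictMono_expInt _).injective (mul_left_cancel₀ hα hst)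
  have hes : ∀ a, ContDiff ℝ ∞ (expInt a) := fun a =>
    contDiff_expInt.comp (contDiff_const.prodMk contDiff_id)
  have hfs : ContDiff ℝ ∞ f := (contDiff_const.mul (hes _)).add contDiff_const
  have hopen : IsOpenMap f := isOpenMap_of_hasStrictDerivAt
    (fun t => hfs.contDiffAt.hasStrictDerivAt' (hfd t) (by simp))
    fun t => mul_ne_zero hα (Real.exp_pos _).ne'
  set J : Set ℝ := expInt (-n * H) ⁻¹' (f '' I) with hJ
  have hJo : IsOpen J := (hopen _ hg.isOpen).preimage (hes _).continuous
  have hJc : J.OrdConnected :=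
    Set.OrdConnected.preimage_mono
      ((hg.ordConnected.isPreconnected.image f hfs.continuous.continuousOn).ordConnected)
      (strictMono_expInt _).monotone
  have hex : ∀ s, ∃ t, s ∈ J → t ∈ I ∧ f t = expInt (-n * H) s := by
    intro s
    by_cases hs : s ∈ J
    · obtain ⟨t, ht, hts⟩ := hs
      exact ⟨t, fun _ => ⟨ht, hts⟩⟩
    · exact ⟨0, fun h => absurd h hs⟩
  choose τ hτ using hex
  refine ⟨fun s => κ * Real.exp (n * h * τ s - n * H * s) * g (τ s), J,
    ⟨hJo, hJc, hg.exponent_ne_zero, ?_, fun s hs => ?_⟩, fun t ht T hT => ?_⟩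
  · intro s hs
    refine ContDiffAt.contDiffWithinAt ?_
    have hτs : ContDiffAt ℝ ∞ τ s := by
      refine contDiffAt_of_expInt_eq (A := fun _ => -n * h)
        (S := fun s => (expInt (-n * H) s - β) / α) contDiffAt_const
        (((hes _).contDiffAt.sub contDiffAt_const).div_const α) ?_
      filter_upwards [hJo.mem_nhds hs] with r hr
      have := (hτ r hr).2
      rw [← this]
      simp only [hf]
      field_simp
      ring
    have hgs : ContDiffAt ℝ ∞ g (τ s) :=
      hg.smooth.contDiffAt (hg.isOpen.mem_nhds (hτ s hs).1)
    refine ContDiffAt.mul (contDiffAt_const.mul (ContDiffAt.exp ?_)) (hgs.comp s hτs)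
    exact (contDiffAt_const.mul hτs).sub (contDiffAt_const.mul contDiffAt_id)
  · exact mul_ne_zero (mul_ne_zero hκ (Real.exp_pos _).ne') (hg.ne_zero _ (hτ s hs).1)
  · have hTJ : T ∈ J := ⟨t, ht, hT.symm⟩
    have : τ T = t := hfinj ((hτ T hTJ).2.trans hT)
    refine ⟨hTJ, ?_⟩
    simp only [this]

namespace IsStandardForm

variable {Ω : Set JointSpace} {Φ : JointSpace → JointSpace} {H α β δ₀ δ₁ : ℝ × ℝ → ℝ}
  {z : JointSpace}

/-- For constants not occurring in `Ω` the requirements are vacuous, and the original tuple serves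
as its own image. -/
theorem maps_class (hΩ : IsTransformationDomain Ω) (hs : IsStandardForm Ω Φ H α β δ₀ δ₁)
    {n h : ℝ} {g : ℝ → ℝ} {I : Set ℝ} (hg : InClass n h g I) :
    ∃ (N H : ℝ) (G : ℝ → ℝ) (J : Set ℝ), InClass N H G J ∧
      (∀ t x u : ℝ, t ∈ I → ![t, x, u, n, h, g t] ∈ Ω →
        Φ ![t, x, u, n, h, g t] 3 = N ∧
        Φ ![t, x, u, n, h, g t] 4 = H ∧
        Φ ![t, x, u, n, h, g t] 0 ∈ J ∧
        Φ ![t, x, u, n, h, g t] 5 = G (Φ ![t, x, u, n, h, g t] 0)) ∧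
      MapsEquation {p | p.1 ∈ I ∧ ![p.1, p.2.1, p.2.2, n, h, g p.1] ∈ Ω}
        (fun t x u => Φ ![t, x, u, n, h, g t] 0)
        (fun t x u => Φ ![t, x, u, n, h, g t] 1)
        (fun t x u => Φ ![t, x, u, n, h, g t] 2)
        n h g N H G := by
  by_cases hc : (n, h) ∈ constants Ω
  swap
  · have hno : ∀ t x u, ![t, x, u, n, h, g t] ∉ Ω := fun t x u hmem => hc ⟨_, hmem, rfl⟩
    exact ⟨n, h, g, I, hg, fun t x u _ hmem => absurd hmem (hno t x u),
      fun v w t x hmem => absurd hmem.2 (hno _ _ _)⟩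
  have hne : α (n, h) ≠ 0 ∧ δ₁ (n, h) ≠ 0 ∧ 0 < δ₁ (n, h) / α (n, h) := by
    obtain ⟨z, hz, hzc⟩ := hc
    have hzc' : (z 3, z 4) = (n, h) := hzc
    rw [← hzc']
    exact ⟨hs.α_ne_zero hz, hs.δ₁_ne_zero hz, hs.div_pos hz⟩
  obtain ⟨hα, hδ₁, hdiv⟩ := hne
  have hn := hg.exponent_ne_zero
  obtain ⟨G, J, hGJ, hG⟩ := exists_image_inClass (H := H (n, h)) (β := β (n, h))
    (κ := δ₁ (n, h) ^ 2 / α (n, h)) hg hα (div_ne_zero (pow_ne_zero 2 hδ₁) hα)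
  have htime : ∀ t x u : ℝ, ![t, x, u, n, h, g t] ∈ Ω →
      expInt (-n * H (n, h)) (Φ ![t, x, u, n, h, g t] 0)
        = α (n, h) * expInt (-n * h) t + β (n, h) := fun t x u hmem => hs.time _ hmem
  have hcoeff : ∀ t x u : ℝ, t ∈ I → ![t, x, u, n, h, g t] ∈ Ω →
      Φ ![t, x, u, n, h, g t] 5 = G (Φ ![t, x, u, n, h, g t] 0) := by
    intro t x u ht hmem
    rw [(hG t ht _ (htime t x u hmem)).2]
    exact hs.coeff _ hmem
  refine ⟨n, H (n, h), G, J, hGJ, fun t x u ht hmem => ⟨hs.exponent _ hmem, hs.damping _ hmem,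
    (hG t ht _ (htime t x u hmem)).1, hcoeff t x u ht hmem⟩, ?_⟩
  rintro v w t x ⟨ht, hmem⟩ hv hw hrel
  have ht : t ∈ I := ht
  have hmem : ![t, x, v t x, n, h, g t] ∈ Ω := hmem
  have hgs : ContDiffAt ℝ ∞ g t := hg.smooth.contDiffAt (hg.isOpen.mem_nhds ht)
  have hι : ContDiffAt ℝ ∞ (fun p : ℝ × ℝ => (![p.1, p.2, v p.1 p.2, n, h, g p.1] : JointSpace))
      (t, x) :=
    contDiffAt_vec contDiffAt_fst contDiffAt_snd hv contDiffAt_const contDiffAt_const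
      (hgs.comp (t, x) contDiffAt_fst)
  have hev : ∀ᶠ p : ℝ × ℝ in 𝓝 (t, x), ![p.1, p.2, v p.1 p.2, n, h, g p.1] ∈ Ω :=
    hι.continuousAt.eventually (hΩ.isOpen.mem_nhds hmem)
  -- The new time is sampled along the line of fixed `x`; by `time_eq` it agrees with its value at
  -- any nearby point of the graph with the same `t`.
  set T : ℝ → ℝ := fun s => Φ ![s, x, v s x, n, h, g s] 0 with hT
  have hevt : ∀ᶠ s in 𝓝 t, ![s, x, v s x, n, h, g s] ∈ Ω := by
    have : ContinuousAt (fun s : ℝ => (s, x)) t := by fun_prop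
    exact this.eventually hev
  have hTrel : ∀ᶠ s in 𝓝 t, expInt (-n * H (n, h)) (T s)
      = α (n, h) * expInt (-n * h) s + β (n, h) := by
    filter_upwards [hevt] with s hmem' using htime s x _ hmem'
  have hTs : ContDiffAt ℝ ∞ T t := by
    refine contDiffAt_of_expInt_eq (A := fun _ => -n * H (n, h))
      (S := fun s => α (n, h) * expInt (-n * h) s + β (n, h)) contDiffAt_const ?_ hTrel
    have hes : ContDiff ℝ ∞ (expInt (-n * h)) :=
      contDiff_expInt.comp (contDiff_const.prodMk contDiff_id)
    exact (contDiffAt_const.mul hes.contDiffAt).add contDiffAt_const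
  have hTd : HasDerivAt T (α (n, h) * Real.exp (n * H (n, h) * T t - n * h * t)) t := by
    have h1 := (hTs.differentiableAt (by simp)).hasDerivAt
    have h2 := ((hasDerivAt_expInt (-n * H (n, h)) (T t)).comp t h1).unique
      ((((hasDerivAt_expInt (-n * h) t).const_mul (α (n, h))).add_const
        (β (n, h))).congr_of_eventuallyEq hTrel)
    refine h1.congr_deriv ?_
    have e1 : Real.exp (n * H (n, h) * T t - n * h * t)
        = Real.exp (-n * h * t) / Real.exp (-n * H (n, h) * T t) := by
      rw [← Real.exp_sub]
      congr 1
      ring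
    rw [e1]
    have := (Real.exp_pos (-n * H (n, h) * T t)).ne'
    rw [← mul_div_assoc, eq_div_iff this]
    linear_combination h2
  have hμ : 0 < (δ₁ (n, h) / α (n, h)) ^ (1 / n) := Real.rpow_pos_of_pos hdiv _
  have hX : Φ ![t, x, v t x, n, h, g t] 1 = δ₁ (n, h) * x + δ₀ (n, h) := hs.space _ hmem
  simp only [hX] at hw ⊢
  refine satisfiesAt_iff_of_standard hα hδ₁ hμ ?_ hTd ?_ (hΩ.u_pos _ hmem) hv hw ?_
  · rw [← Real.rpow_mul hdiv.le, one_div_mul_cancel hn, Real.rpow_one]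
  · exact (hG t ht _ (htime t x _ hmem)).2
  · have hev' : ∀ᶠ p : ℝ × ℝ in 𝓝 (t, x), ![p.1, x, v p.1 x, n, h, g p.1] ∈ Ω :=
      (continuousAt_fst (p := (t, x))).eventually hevt
    filter_upwards [hrel, hev, hev'] with p h1 h2 h3
    have e0 : Φ ![p.1, p.2, v p.1 p.2, n, h, g p.1] 0 = T p.1 :=
      hs.time_eq h3 h2 rfl rfl rfl
    have e1 : Φ ![p.1, p.2, v p.1 p.2, n, h, g p.1] 1 = δ₁ (n, h) * p.2 + δ₀ (n, h) :=
      hs.space _ h2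
    have e2 : Φ ![p.1, p.2, v p.1 p.2, n, h, g p.1] 2 = (δ₁ (n, h) / α (n, h)) ^ (1 / n)
        * Real.exp (h * p.1 - H (n, h) * Φ ![p.1, p.2, v p.1 p.2, n, h, g p.1] 0) * v p.1 p.2 :=
      hs.dependent _ h2
    rw [e0] at e2
    rw [e0, e1, e2] at h1
    exact h1

theorem isGenEquivTransformation (hΩ : IsTransformationDomain Ω)
    (hs : IsStandardForm Ω Φ H α β δ₀ δ₁) : IsGenEquivTransformation Ω Φ where
  smooth := contDiffOn_pi.2 fun i => hs.contDiffOn_component hΩ i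
  nondegenerate _ hz := hs.det_ne_zero hΩ hz
  u_pos z hz := by
    rw [hs.dependent z hz]
    exact mul_pos (mul_pos (Real.rpow_pos_of_pos (hs.div_pos hz) _) (Real.exp_pos _))
      (hΩ.u_pos z hz)
  maps_class _ _ _ _ hg := hs.maps_class hΩ hg

end IsStandardForm

end GenBurgers

/-! ### The classification -/

theorem mainTheorem5 (Ω : Set GenBurgers.JointSpace) (hΩ : GenBurgers.IsTransformationDomain Ω)
    (Φ : GenBurgers.JointSpace → GenBurgers.JointSpace) :
    GenBurgers.IsGenEquivTransformation Ω Φ ↔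
      ∃ H α β δ₀ δ₁ : ℝ × ℝ → ℝ,
        ContDiffOn ℝ ∞ H (GenBurgers.constants Ω) ∧
        ContDiffOn ℝ ∞ α (GenBurgers.constants Ω) ∧
        ContDiffOn ℝ ∞ β (GenBurgers.constants Ω) ∧
        ContDiffOn ℝ ∞ δ₀ (GenBurgers.constants Ω) ∧
        ContDiffOn ℝ ∞ δ₁ (GenBurgers.constants Ω) ∧
        (∀ n h : ℝ, (n, h) ∈ GenBurgers.constants Ω →
          deriv (fun k => H (n, k)) h ≠ 0 ∧ 0 < α (n, h) * δ₁ (n, h)) ∧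
        ∀ t x u n h g : ℝ, ![t, x, u, n, h, g] ∈ Ω →
          ∃ T : ℝ, GenBurgers.TimeRelation n h (H (n, h)) (α (n, h)) (β (n, h)) t T ∧
            Φ ![t, x, u, n, h, g] =
              ![T,
                δ₁ (n, h) * x + δ₀ (n, h),
                (δ₁ (n, h) / α (n, h)) ^ (1 / n) * Real.exp (h * t - H (n, h) * T) * u,
                n,
                H (n, h),
                δ₁ (n, h) ^ 2 / α (n, h) * Real.exp (n * h * t - n * H (n, h) * T) * g] := by
  refine ⟨GenBurgers.exists_parameters hΩ, ?_⟩
  rintro ⟨H, α, β, δ₀, δ₁, hH, hα, hβ, hδ₀, hδ₁, hc, hΦ⟩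
  have hform : ∀ z ∈ Ω, GenBurgers.TimeRelation (z 3) (z 4) (H (z 3, z 4)) (α (z 3, z 4))
      (β (z 3, z 4)) (z 0) (Φ z 0) ∧ Φ z = ![Φ z 0, δ₁ (z 3, z 4) * z 1 + δ₀ (z 3, z 4),
        (δ₁ (z 3, z 4) / α (z 3, z 4)) ^ (1 / z 3)
          * Real.exp (z 4 * z 0 - H (z 3, z 4) * Φ z 0) * z 2, z 3, H (z 3, z 4),
        δ₁ (z 3, z 4) ^ 2 / α (z 3, z 4)
          * Real.exp (z 3 * z 4 * z 0 - z 3 * H (z 3, z 4) * Φ z 0) * z 5] := by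
    intro z hz
    obtain ⟨T, hT, hΦz⟩ := hΦ (z 0) (z 1) (z 2) (z 3) (z 4) (z 5)
      (by rwa [GenBurgers.eq_vec])
    rw [GenBurgers.eq_vec] at hΦz
    have h0 : Φ z 0 = T := congrFun hΦz 0
    rw [h0]
    exact ⟨hT, hΦz⟩
  exact GenBurgers.IsStandardForm.isGenEquivTransformation hΩ
    { smooth_H := hH
      smooth_α := hα
      smooth_β := hβ
      smooth_δ₀ := hδ₀
      smooth_δ₁ := hδ₁
      deriv_ne_zero := fun z hz => (hc _ _ ⟨z, hz, rfl⟩).1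
      pos := fun z hz => (hc _ _ ⟨z, hz, rfl⟩).2
      time := fun z hz =>
        (GenBurgers.timeRelation_iff (hΩ.n_ne_zero z hz)).1 (hform z hz).1
      space := fun z hz => congrFun (hform z hz).2 1
      dependent := fun z hz => congrFun (hform z hz).2 2
      exponent := fun z hz => congrFun (hform z hz).2 3
      damping := fun z hz => congrFun (hform z hz).2 4
      coeff := fun z hz => congrFun (hform z hz).2 5 }
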